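/- Let $G$ be a locally compact (Hausdorff) group with a fixed left Haar measure. A $G$-algebra is a $C^*$-algebra $A$ with a homomorphism $\alpha:G\to\mathrm{Aut}(A)$ such that $g\mapsto\alpha_g(a)$ is norm continuous for every $a\in A$; $C_c(G,A)$ carries its usual convolution $*$-algebra structure. Write $\|\cdot\|_{\max}$ for the supremum of the norms of the integrated forms $\pi\rtimes u$ over all covariant representations $(\pi,u)$ of $(A,G,\alpha)$ on Hilbert spaces, and $\|\cdot\|_r$ for the operator norm of the regular representation on $L^2(G,A)$. A crossed-product functor $\rtimes_\mu$ assigns to every $G$-algebra $A$ a $C^*$-algebra $A\rtimes_\mu G$ that is the completion of $C_c(G,A)$ in a $C^*$-norm $\|\cdot\|_\mu$ with $\|\cdot\|_r\le\|\cdot\|_\mu\le\|\cdot\|_{\max}$, such that for every equivariant $*$-homomorphism $\phi:A\to B$ the map $f\mapsto\phi\circ f$ extends to a $*$-homomorphism $\phi\rtimes_\mu G:A\rtimes_\mu G\to B\rtimes_\mu G$. If $I\subseteq A$ is an equivariant inclusion, $I\rtimes_{\mu,A}G$ denotes the closure of $C_c(G,I)$ in $A\rtimes_\mu G$. The functor $\rtimes_\mu$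 is half-exact if for every short exact sequence $0\to I\to A\xrightarrow{\rho}B\to0$ of $G$-algebras the sequence $$0\to I\rtimes_{\mu,A}G\to A\rtimes_\mu G\xrightarrow{\rho\rtimes_\mu G}B\rtimes_\mu G\to0$$ is exact. A crossed-product functor $\rtimes_\nu$ dominates $\rtimes_\mu$ if $\|f\|_\nu\ge\|f\|_\mu$ for all $G$-algebras $A$ and all $f\in C_c(G,A)$. Let $\rtimes_\mu$ be a crossed-product functor for $G$. For an equivariant surjective $*$-homomorphism $\pi:C\to A$ of $G$-algebras with kernel $I$ and for $f\in C_c(G,A)$, let $\|f\|_\pi$ be the norm of the class of $c$ in $(C\rtimes_\mu G)/(I\rtimes_{\mu,C}G)$, where $c\in C_c(G,C)$ is any function with $\pi\circ c=f$ (the norm does not depend on the choice of $c$), and let $$\|f\|_{\mathcal E(\mu)}=\sup\{\|f\|_\pi : \pi:C\to A\text{ an equivariant surjection of $G$-algebras}\}.$$ Proposition. The supremum is finite, and the completions $A\rtimes_{\mathcal E(\mu)}G$ of $C_c(G,A)$ in the norms $\|\cdot\|_{\mathcal E(\mu)}$ form a crossed-product functor $\rtimes_{\mathcal E(\mu)}$.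 The functor $\rtimes_{\mathcal E(\mu)}$ is half-exact. It dominates $\rtimes_\mu$, and it is minimal amongst all half-exact crossed-product functors that dominate $\rtimes_\mu$: every half-exact crossed-product functor $\rtimes_\nu$ that dominates $\rtimes_\mu$ also dominates $\rtimes_{\mathcal E(\mu)}$. -/

import Mathlib

open MeasureTheory Topology
open scoped CompactlySupported NNReal

namespace ExoticCrossedProduct

noncomputable section

universe u

/-! ### `G`-algebras and equivariant maps -/

/-- A `G`-algebra: a (not necessarily unital) C⋆-algebra with a continuous action of `G` by
`*`-automorphisms, continuity meaning that `g ↦ α_g(a)` is norm continuous for every `a`. -/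
structure GAlgebra (G : Type u) [Group G] [TopologicalSpace G] where
  carrier : Type u
  [cstar : NonUnitalCStarAlgebra carrier]
  act : G →* (carrier ≃⋆ₐ[ℂ] carrier)
  continuous_act : ∀ a : carrier, Continuous fun g => act g a

attribute [instance] GAlgebra.cstar

instance (G : Type u) [Group G] [TopologicalSpace G] : CoeSort (GAlgebra G) (Type u) :=
  ⟨GAlgebra.carrier⟩

/-- Equivariant `*`-homomorphisms. -/
structure GHom {G : Type u} [Group G] [TopologicalSpace G] (A B : GAlgebra G) where
  toHom : A →⋆ₙₐ[ℂ] B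
  map_act : ∀ (g : G) (a : A), toHom (A.act g a) = B.act g (toHom a)

theorem continuous_starHom {A B : Type*} [NonUnitalCStarAlgebra A] [NonUnitalCStarAlgebra B]
    (φ : A →⋆ₙₐ[ℂ] B) : Continuous φ :=
  AddMonoidHomClass.continuous_of_bound φ 1 fun a => by
    simpa using NonUnitalStarAlgHom.norm_apply_le φ a

section Basic

variable {G : Type u} [Group G] [TopologicalSpace G]

instance (A B : GAlgebra G) : CoeFun (GHom A B) (fun _ => A → B) := ⟨fun φ => φ.toHom⟩

/-- The identity as an equivariant map. -/
def GHom.id (A : GAlgebra G) : GHom A A where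
  toHom := NonUnitalStarAlgHom.id ℂ A
  map_act _ _ := rfl

/-- Composition of equivariant maps. -/
def GHom.comp {A B C : GAlgebra G} (ψ : GHom B C) (φ : GHom A B) : GHom A C where
  toHom := ψ.toHom.comp φ.toHom
  map_act g a := by simp [φ.map_act, ψ.map_act]

theorem GHom.continuous {A B : GAlgebra G} (φ : GHom A B) : Continuous φ.toHom :=
  continuous_starHom φ.toHom

theorem GAlgebra.norm_act (A : GAlgebra G) (g : G) (a : A) : ‖A.act g a‖ = ‖a‖ :=
  NonUnitalStarAlgHom.norm_map (A.act g) (A.act g).injective a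

/-- A strongly continuous action on a C⋆-algebra is jointly continuous. -/
theorem GAlgebra.continuous_act_uncurry (A : GAlgebra G) :
    Continuous fun p : G × A => A.act p.1 p.2 := by
  rw [continuous_iff_continuousAt]
  rintro ⟨g₀, a₀⟩
  rw [ContinuousAt, tendsto_iff_norm_sub_tendsto_zero]
  have h1 : Filter.Tendsto
      (fun p : G × A => ‖p.2 - a₀‖ + ‖A.act p.1 a₀ - A.act g₀ a₀‖) (𝓝 (g₀, a₀)) (𝓝 0) := by
    have hc : Continuous
        (fun p : G × A => ‖p.2 - a₀‖ + ‖A.act p.1 a₀ - A.act g₀ a₀‖) := by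
      have := (A.continuous_act a₀).comp (continuous_fst (X := G) (Y := A))
      exact ((continuous_snd.sub continuous_const).norm).add
        ((this.sub continuous_const).norm)
    simpa using hc.tendsto (g₀, a₀)
  refine squeeze_zero (fun _ => norm_nonneg _) (fun p => ?_) h1
  calc ‖A.act p.1 p.2 - A.act g₀ a₀‖
      = ‖A.act p.1 (p.2 - a₀) + (A.act p.1 a₀ - A.act g₀ a₀)‖ := by
        rw [map_sub]; congr 1; abel
    _ ≤ ‖A.act p.1 (p.2 - a₀)‖ + ‖A.act p.1 a₀ - A.act g₀ a₀‖ := norm_add_le _ _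
    _ = _ := by rw [A.norm_act]

/-- The integrated form `φ ⋊ G : C_c(G, A) → C_c(G, B)`, `f ↦ φ ∘ f`, of an equivariant map. -/
def pushforward {A B : GAlgebra G} (φ : GHom A B) (f : C_c(G, A)) : C_c(G, B) where
  toFun t := φ (f t)
  continuous_toFun := φ.continuous.comp f.continuous
  hasCompactSupport' := f.hasCompactSupport.comp_left (map_zero φ.toHom)

/-- For a subspace `I` of a `G`-algebra `A`, the functions in `C_c(G, A)` with values in `I`;
that is `C_c(G, I)`, regarded as a subspace of `C_c(G, A)`. -/
def ccIn {A : GAlgebra G} (I : Submodule ℂ A) : Submodule ℂ C_c(G, A) where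
  carrier := {f | ∀ t, f t ∈ I}
  add_mem' hf hg t := I.add_mem (hf t) (hg t)
  zero_mem' _ := I.zero_mem
  smul_mem' c _ hf t := I.smul_mem c (hf t)

end Basic

section Main

variable {G : Type u} [Group G] [TopologicalSpace G] [IsTopologicalGroup G]
  [LocallyCompactSpace G]

/-! ### The `*`-algebra `C_c(G, A)` -/

/-- Behaviour of left Haar integrals under right translation. -/
theorem integral_mul_right_eq [MeasurableSpace G] [BorelSpace G] (f : C_c(G, ℝ)) (g : G) :
    ∫ s, f (s * g) ∂Measure.haar
      = (Measure.modularCharacter g : ℝ) * ∫ s, f s ∂(Measure.haar : Measure G) := by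
  have h := Measure.integral_isMulLeftInvariant_eq_smul_of_hasCompactSupport
    (Measure.map (· * g) (Measure.haar : Measure G)) Measure.haar f.continuous
    f.hasCompactSupport
  rw [← Measure.modularCharacterFun_eq_haarScalarFactor] at h
  rw [integral_map (by fun_prop) f.continuous.aestronglyMeasurable,
    integral_smul_nnreal_measure] at h
  exact h

/-- The modular character is continuous. -/
theorem continuous_modularCharacter :
    Continuous fun g : G => (Measure.modularCharacter g : ℝ) := by
  borelize G
  obtain ⟨f₀, hf₀, f_nonneg, f_one⟩ :
    ∃ f : C(G, ℝ), HasCompactSupport f ∧ 0 ≤ f ∧ f 1 ≠ 0 := exists_continuous_nonneg_pos 1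
  set f : C_c(G, ℝ) := ⟨f₀, hf₀⟩ with hfdef
  have hpos : (∫ s, f s ∂(Measure.haar : Measure G)) ≠ 0 :=
    ne_of_gt (f₀.continuous.integral_pos_of_hasCompactSupport_nonneg_nonzero hf₀ f_nonneg f_one)
  have heq : (fun g : G => (Measure.modularCharacter g : ℝ)) = fun g =>
      (∫ s, f (s * g) ∂Measure.haar) / ∫ s, f s ∂(Measure.haar : Measure G) := by
    funext g
    rw [integral_mul_right_eq, mul_div_cancel_right₀ _ hpos]
  rw [heq]
  refine Continuous.div_const ?_ _
  rw [continuous_iff_continuousAt]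
  intro g₀
  obtain ⟨K, hK, hg₀⟩ := exists_compact_mem_nhds g₀
  have hcomp : IsCompact ((fun p : G × G => p.1 * p.2⁻¹) '' (tsupport f ×ˢ K)) :=
    (f.hasCompactSupport.isCompact.prod hK).image (by fun_prop)
  refine ContinuousOn.continuousAt (s := K) ?_ hg₀
  refine continuousOn_integral_of_compact_support hcomp ?_ ?_
  · exact (f.continuous.comp (by fun_prop : Continuous fun p : G × G => p.2 * p.1)).continuousOn
  · intro g s hg hs
    by_contra hne
    exact hs ⟨(s * g, g), ⟨subset_tsupport _ hne, hg⟩, by simp⟩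

/-- The involution `f^*(t) = Δ(t)⁻¹ α_t(f(t⁻¹))^*` on `C_c(G, A)`. Here `Δ` is the modular function
normalised by `∫ f(s g) ds = Δ(g)⁻¹ ∫ f(s) ds`, which is the inverse of `Measure.modularCharacter`
(see `integral_mul_right_eq`). -/
def involution {A : GAlgebra G} (f : C_c(G, A)) : C_c(G, A) where
  toFun t := ((Measure.modularCharacter t : ℝ) : ℂ) • star (A.act t (f t⁻¹))
  continuous_toFun := by
    have h1 : Continuous fun t : G => A.act t (f t⁻¹) :=
      A.continuous_act_uncurry.comp
        (continuous_id.prodMk (f.continuous.comp continuous_inv))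
    exact (Complex.continuous_ofReal.comp continuous_modularCharacter).smul h1.star
  hasCompactSupport' := by
    refine HasCompactSupport.intro (K := (tsupport f)⁻¹) f.hasCompactSupport.isCompact.inv ?_
    intro t ht
    have : f t⁻¹ = 0 := image_eq_zero_of_notMem_tsupport (by simpa using ht)
    simp [this]

variable [MeasurableSpace G] [BorelSpace G]

/-- The convolution `(f * g)(t) = ∫ f(s) α_s(g(s⁻¹ t)) ds` on `C_c(G, A)`, with respect to left
Haar measure. -/
def conv {A : GAlgebra G} (f g : C_c(G, A)) : C_c(G, A) where
  toFun t := ∫ s, f s * A.act s (g (s⁻¹ * t)) ∂Measure.haar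
  continuous_toFun := by
    rw [← continuousOn_univ]
    refine continuousOn_integral_of_compact_support f.hasCompactSupport.isCompact ?_ ?_
    · refine Continuous.continuousOn ?_
      have h1 : Continuous fun p : G × G => A.act p.2 (g (p.2⁻¹ * p.1)) :=
        A.continuous_act_uncurry.comp
          (continuous_snd.prodMk (g.continuous.comp (by fun_prop)))
      exact (f.continuous.comp continuous_snd).mul h1
    · intro t s _ hs
      simp [image_eq_zero_of_notMem_tsupport hs]
  hasCompactSupport' := by
    refine HasCompactSupport.intro
      (K := (fun p : G × G => p.1 * p.2) '' (tsupport f ×ˢ tsupport g))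
      ((f.hasCompactSupport.isCompact.prod g.hasCompactSupport.isCompact).image
        continuous_mul) ?_
    intro t ht
    have : ∀ s, f s * A.act s (g (s⁻¹ * t)) = 0 := by
      intro s
      by_cases hs : s ∈ tsupport f
      · have : s⁻¹ * t ∉ tsupport g := fun h => ht ⟨(s, s⁻¹ * t), ⟨hs, h⟩, by simp⟩
        simp [image_eq_zero_of_notMem_tsupport this]
      · simp [image_eq_zero_of_notMem_tsupport hs]
    simp [this]

/-! ### The maximal norm and the regular representation -/

/-- A covariant representation `(π, u)` of a `G`-algebra on a Hilbert space. -/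
structure CovariantRep (A : GAlgebra G) where
  H : Type u
  [normed : NormedAddCommGroup H]
  [inner : InnerProductSpace ℂ H]
  [complete : CompleteSpace H]
  π : A →⋆ₙₐ[ℂ] (H →L[ℂ] H)
  u : G →* unitary (H →L[ℂ] H)
  continuous_u : ∀ ξ : H, Continuous fun g => (u g : H →L[ℂ] H) ξ
  covariant : ∀ (g : G) (a : A),
    π (A.act g a) = (u g : H →L[ℂ] H) * π a * star (u g : H →L[ℂ] H)

attribute [instance] CovariantRep.normed CovariantRep.inner CovariantRep.complete

/-- The integrated form `(π ⋊ u)(f) ξ = ∫ π(f(s)) u_s ξ ds`. -/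
def CovariantRep.integrated {A : GAlgebra G} (R : CovariantRep A) (f : C_c(G, A)) (ξ : R.H) :
    R.H :=
  ∫ s, R.π (f s) ((R.u s : R.H →L[ℂ] R.H) ξ) ∂Measure.haar

/-- The norms of the vectors `(π ⋊ u)(f) ξ`, for all covariant representations `(π, u)` and all
vectors `ξ` of norm at most one. -/
def maxNormValues {A : GAlgebra G} (f : C_c(G, A)) : Set ℝ :=
  {r | ∃ (R : CovariantRep A) (ξ : R.H), ‖ξ‖ ≤ 1 ∧ r = ‖R.integrated f ξ‖}

/-- The maximal norm: the supremum over all covariant representations of the operator norm of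
`(π ⋊ u)(f)`. -/
def maxNorm {A : GAlgebra G} (f : C_c(G, A)) : ℝ := sSup (maxNormValues f)

/-- The supremum defining the maximal norm is that of a bounded set. -/
theorem bddAbove_maxNormValues {A : GAlgebra G} (f : C_c(G, A)) :
    BddAbove (maxNormValues f) := by
  refine ⟨∫ s, ‖f s‖ ∂Measure.haar, ?_⟩
  rintro r ⟨R, ξ, hξ, rfl⟩
  refine norm_integral_le_of_norm_le
    (f.continuous.norm.integrable_of_hasCompactSupport f.hasCompactSupport.norm)
    (Filter.Eventually.of_forall fun s => ?_)
  have h1 : ‖R.π (f s)‖ ≤ ‖f s‖ := NonUnitalStarAlgHom.norm_apply_le R.π (f s)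
  have h2 : ‖(R.u s : R.H →L[ℂ] R.H) ξ‖ ≤ 1 := by
    refine le_trans (ContinuousLinearMap.le_opNorm _ _) ?_
    have h3 : ‖(R.u s : R.H →L[ℂ] R.H)‖ ≤ 1 := by
      rcases subsingleton_or_nontrivial (R.H →L[ℂ] R.H) with _ | _
      · simp [Subsingleton.elim (R.u s : R.H →L[ℂ] R.H) 0]
      · exact (CStarRing.norm_coe_unitary (R.u s)).le
    exact mul_le_one₀ h3 (norm_nonneg _) hξ
  calc ‖R.π (f s) ((R.u s : R.H →L[ℂ] R.H) ξ)‖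
      ≤ ‖R.π (f s)‖ * ‖(R.u s : R.H →L[ℂ] R.H) ξ‖ := ContinuousLinearMap.le_opNorm _ _
    _ ≤ ‖f s‖ * 1 := mul_le_mul h1 h2 (norm_nonneg _) (norm_nonneg _)
    _ = ‖f s‖ := mul_one _

/-- The norm `‖∫ ξ(s)^* ξ(s) ds‖^{1/2}` of the Hilbert `A`-module `L²(G, A)`. -/
def l2Norm {A : GAlgebra G} (ξ : G → A) : ℝ :=
  √‖∫ s, star (ξ s) * ξ s ∂Measure.haar‖

/-- The regular representation of `C_c(G, A)` on (the dense subspace `C_c(G, A)` of) the Hilbert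
`A`-module `L²(G, A)`: `(Λ(f) ξ)(s) = ∫ α_{s⁻¹}(f(t)) ξ(t⁻¹ s) dt`, the integrated form of the
covariant pair `(a ξ)(s) = α_{s⁻¹}(a) ξ(s)`, `(λ_t ξ)(s) = ξ(t⁻¹ s)`. -/
def regularRep {A : GAlgebra G} (f ξ : C_c(G, A)) : G → A :=
  fun s => ∫ t, A.act s⁻¹ (f t) * ξ (t⁻¹ * s) ∂Measure.haar

/-! ### Crossed-product functors -/

variable (G) in
/-- A crossed-product functor for `G`: to every `G`-algebra `A` it assigns a C⋆-algebra
`A ⋊_μ G = obj A` which is a completion of the `*`-algebra `C_c(G, A)` for a C⋆-norm lying between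
the reduced and the maximal norm, in such a way that for every equivariant `φ : A → B` the map
`f ↦ φ ∘ f` extends to a `*`-homomorphism `A ⋊_μ G → B ⋊_μ G`. (The extension is unique, so that
identities and compositions are respected: see `map_id`, `map_comp`.) -/
structure CrossedProductFunctor where
  obj : GAlgebra G → Type u
  [cstar : ∀ A, NonUnitalCStarAlgebra (obj A)]
  /-- the inclusion of `C_c(G, A)` -/
  ι : ∀ A : GAlgebra G, C_c(G, A) →ₗ[ℂ] obj A
  ι_conv : ∀ (A : GAlgebra G) (f g : C_c(G, A)), ι A (conv f g) = ι A f * ι A g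
  ι_involution : ∀ (A : GAlgebra G) (f : C_c(G, A)), ι A (involution f) = star (ι A f)
  ι_injective : ∀ A : GAlgebra G, Function.Injective (ι A)
  ι_dense : ∀ A : GAlgebra G, DenseRange (ι A)
  /-- the norm dominates the reduced norm, i.e. the operator norm of the regular representation -/
  regular_le : ∀ (A : GAlgebra G) (f ξ : C_c(G, A)),
    l2Norm (regularRep f ξ) ≤ ‖ι A f‖ * l2Norm ξ
  /-- the norm is dominated by the maximal norm -/
  le_max : ∀ (A : GAlgebra G) (f : C_c(G, A)), ‖ι A f‖ ≤ maxNorm f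
  /-- the map `φ ⋊_μ G` -/
  map : ∀ {A B : GAlgebra G}, GHom A B → (obj A →⋆ₙₐ[ℂ] obj B)
  map_ι : ∀ {A B : GAlgebra G} (φ : GHom A B) (f : C_c(G, A)),
    map φ (ι A f) = ι B (pushforward φ f)

attribute [instance] CrossedProductFunctor.cstar

namespace CrossedProductFunctor

theorem map_id (μ : CrossedProductFunctor G) (A : GAlgebra G) (x : μ.obj A) :
    μ.map (GHom.id A) x = x := by
  refine congrFun (DenseRange.equalizer (μ.ι_dense A) (continuous_starHom (μ.map (GHom.id A)))
    continuous_id (funext fun f => ?_)) x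
  simp only [Function.comp_apply, μ.map_ι, id]
  rfl

theorem map_comp (μ : CrossedProductFunctor G) {A B C : GAlgebra G} (ψ : GHom B C)
    (φ : GHom A B) (x : μ.obj A) : μ.map (ψ.comp φ) x = μ.map ψ (μ.map φ x) := by
  refine congrFun (DenseRange.equalizer (μ.ι_dense A) (continuous_starHom (μ.map (ψ.comp φ)))
    ((continuous_starHom (μ.map ψ)).comp (continuous_starHom (μ.map φ))) (funext fun f => ?_)) x
  simp only [Function.comp_apply, μ.map_ι]
  rfl

/-- For `I ⊆ A`, the completion `I ⋊_{μ,A} G` of `C_c(G, I)` in the norm inherited from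
`A ⋊_μ G`, realised as the closure of `C_c(G, I)` in `A ⋊_μ G`. -/
def relative (μ : CrossedProductFunctor G) {A : GAlgebra G} (I : Submodule ℂ A) :
    Submodule ℂ (μ.obj A) :=
  ((ccIn I).map (μ.ι A)).topologicalClosure

/-- The functor `⋊_μ` is half-exact: for every short exact sequence `0 → I → A → B → 0` of
`G`-algebras, the sequence `0 → I ⋊_{μ,A} G → A ⋊_μ G → B ⋊_μ G → 0` is exact. Here `I` is
identified with its image in `A`. -/
def HalfExact (μ : CrossedProductFunctor G) : Prop :=
  ∀ (I A B : GAlgebra G) (j : GHom I A) (ρ : GHom A B),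
    Function.Injective j → Function.Exact j ρ → Function.Surjective ρ →
      Function.Injective (μ.relative (LinearMap.range (j.toHom : I →ₗ[ℂ] A))).subtype ∧
      Function.Exact (μ.relative (LinearMap.range (j.toHom : I →ₗ[ℂ] A))).subtype (μ.map ρ) ∧
      Function.Surjective (μ.map ρ)

/-- `⋊_ν` dominates `⋊_μ`: `‖f‖_ν ≥ ‖f‖_μ` on all `C_c(G, A)`. -/
def Dominates (ν μ : CrossedProductFunctor G) : Prop :=
  ∀ (A : GAlgebra G) (f : C_c(G, A)), ‖μ.ι A f‖ ≤ ‖ν.ι A f‖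

/-! ### The functor `⋊_{E(μ)}` -/

/-- `I ⋊_{μ,C} G` for the kernel `I` of an equivariant map `π : C → A`. -/
def relKer (μ : CrossedProductFunctor G) {C A : GAlgebra G} (π : GHom C A) :
    Submodule ℂ (μ.obj C) :=
  μ.relative (LinearMap.ker (π.toHom : C →ₗ[ℂ] A))

/-- The `π`-norm of `f ∈ C_c(G, A)` for an equivariant surjection `π : C → A` with kernel `I`: the
norm in `(C ⋊_μ G) / (I ⋊_{μ,C} G)` of the class of any `c ∈ C_c(G, C)` with `π ∘ c = f`. This norm
does not depend on the choice of `c` (see `piNorm_pushforward`), so that the infimum is over a set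
with a single element. -/
def piNorm (μ : CrossedProductFunctor G) {C A : GAlgebra G} (π : GHom C A) (f : C_c(G, A)) : ℝ :=
  sInf {r | ∃ c : C_c(G, C), pushforward π c = f ∧
    r = ‖(Submodule.Quotient.mk (μ.ι C c) : μ.obj C ⧸ μ.relKer π)‖}

theorem piNorm_pushforward (μ : CrossedProductFunctor G) {C A : GAlgebra G} (π : GHom C A)
    (c : C_c(G, C)) : μ.piNorm π (pushforward π c) =
      ‖(Submodule.Quotient.mk (μ.ι C c) : μ.obj C ⧸ μ.relKer π)‖ := by
  have : {r | ∃ c' : C_c(G, C), pushforward π c' = pushforward π c ∧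
      r = ‖(Submodule.Quotient.mk (μ.ι C c') : μ.obj C ⧸ μ.relKer π)‖} =
      {‖(Submodule.Quotient.mk (μ.ι C c) : μ.obj C ⧸ μ.relKer π)‖} := by
    ext r
    constructor
    · rintro ⟨c', h, rfl⟩
      have h2 : (Submodule.Quotient.mk (μ.ι C c') : μ.obj C ⧸ μ.relKer π)
          = Submodule.Quotient.mk (μ.ι C c) := by
        rw [Submodule.Quotient.eq, ← map_sub]
        refine Submodule.le_topologicalClosure _ (Submodule.mem_map_of_mem fun t => ?_)
        have h3 : π (c' t) = π (c t) := DFunLike.congr_fun h t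
        change π.toHom (c' t - c t) = 0
        rw [map_sub, h3, sub_self]
      simp [h2]
    · rintro rfl
      exact ⟨c, rfl, rfl⟩
  rw [piNorm, this, csInf_singleton]

/-- `E` is the crossed product `⋊_{E(μ)}`: for every `G`-algebra `A`, the norm of `A ⋊_E G` on
`C_c(G, A)` is the `E(μ)`-norm, i.e. the supremum of the `π`-norms over all equivariant surjections
`π : C → A` of `G`-algebras (and in particular this supremum is finite). -/
def IsHalfExactification (μ E : CrossedProductFunctor G) : Prop :=
  ∀ (A : GAlgebra G) (f : C_c(G, A)),
    IsLUB {r | ∃ (C : GAlgebra G) (π : GHom C A), Function.Surjective π ∧ r = μ.piNorm π f}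
      ‖E.ι A f‖

end CrossedProductFunctor

end Main

end

end ExoticCrossedProduct

/-! The supremum defining the `E(μ)`-norm is attained by one surjection, the same for all functions
in `C_c(G, A)`. Surjections onto `A` form a proper class, but the norms they induce form a set.
Choose a surjection for each norm and take the fibre product over `A`. It maps to every chosen
algebra over `A`, and quotient norms decrease along such maps, so its norm dominates all the others
(`exists_universal_surjection`). The analytic point is that the fibre product still surjects onto
`A` (`fibreProductBase_surjective`). Bounded families of lifts need not have continuous orbits, so
they are averaged over `G` with one weight in all coordinates. This gives dense range, and ranges of
`*`-homomorphisms are closed. Hence `A ⋊_{E(μ)} G` is a single quotient `(C ⋊_μ G) / (I ⋊_{μ,C} G)`.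

This quotient norm is at most the maximal norm. A positive functional on the quotient gives, by GNS,
a Hilbert space valued map on `C_c(G, A)`. Left multiplication by `A` and translation by `G` extend
to a covariant representation there, and its integrated form is the GNS representation
(`IsDenseRep.norm_le_maxNorm`). Functoriality along `φ : A → B` comes from pulling the cover of `B`
back along `φ` and comparing the result with the cover of `A` (`piNorm_universal_pushforward_le`).

For half-exactness, let `π : C → A` be the universal cover and `ρ : A → B` a surjection. The
composite `ρ ∘ π` is itself one of the surjections onto `B` in the supremum. If `ρ ∘ f` has small
norm, a lift of `f` to `C` can therefore be corrected by a function with values in `ker (ρ ∘ π)`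
until it is small. Pushed down by `π`, the correction has values in `ker ρ`
(`mem_relKer_of_map_eq_zero`).

For minimality, half-exactness of `ν` makes the `ν`-norm on `A` the quotient norm along every
surjection `C → A`. It thus dominates the corresponding quotient of the smaller `μ`-norm
(`piNorm_le_of_halfExact`). -/

/-! ### Quotients of C⋆-algebras by closed ideals -/

/-- A closed two-sided `*`-ideal of a C⋆-algebra. -/
structure IsCStarIdeal {X : Type*} [NonUnitalCStarAlgebra X] (J : Submodule ℂ X) : Prop where
  closed : IsClosed (J : Set X)
  mul_left : ∀ (x : X) {j : X}, j ∈ J → x * j ∈ J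
  mul_right : ∀ {j : X} (x : X), j ∈ J → j * x ∈ J
  star_mem : ∀ {j : X}, j ∈ J → star j ∈ J

/-- The inequality `2δ|t| ≤ δ² + t²` controls one factor, and the other is at most one. This is the
scalar form of the smallness of `g * j * g` below. -/
theorem abs_mul_div_sq_le {δ t : ℝ} (hδ : 0 < δ) :
    |t * (δ ^ 2 / (δ ^ 2 + t ^ 2)) * (δ ^ 2 / (δ ^ 2 + t ^ 2))| ≤ δ := by
  have h0 : 0 < δ ^ 2 + t ^ 2 := by positivity
  have h1 : |δ ^ 2 / (δ ^ 2 + t ^ 2)| ≤ 1 := by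
    rw [abs_of_nonneg (by positivity), div_le_one h0]; nlinarith [sq_nonneg t]
  have h2 : |t * (δ ^ 2 / (δ ^ 2 + t ^ 2))| ≤ δ := by
    rw [abs_mul, abs_of_nonneg (by positivity : 0 ≤ δ ^ 2 / (δ ^ 2 + t ^ 2)), mul_div_assoc',
      div_le_iff₀ h0]
    nlinarith [sq_nonneg (|t| - δ), sq_abs t, abs_nonneg t,
      mul_nonneg hδ.le (sq_nonneg (|t| - δ)), mul_nonneg (abs_nonneg t) (sq_nonneg δ),
      mul_nonneg hδ.le (sq_nonneg δ), mul_nonneg hδ.le (sq_nonneg (|t|))]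
  rw [abs_mul]
  calc _ ≤ δ * 1 := mul_le_mul h2 h1 (abs_nonneg _) hδ.le
    _ = δ := mul_one _

/-- For a self-adjoint `j` there are elements `e = j * (⋯)` for which `1 - e` is a self-adjoint
contraction that almost annihilates `j`. -/
theorem exists_approx_unit_of_isSelfAdjoint {X : Type*} [NonUnitalCStarAlgebra X] {j : X}
    (hj : IsSelfAdjoint j) {δ : ℝ} (hδ : 0 < δ) :
    ∃ (c : ℂ) (w : X), let g : Unitization ℂ X := 1 - (c • j + j * w : X)
      IsSelfAdjoint g ∧ ‖g‖ ≤ 1 ∧ ‖g * j * g‖ ≤ δ := by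
  let a : Unitization ℂ X := j
  have ha : IsSelfAdjoint a := hj.inr ℂ
  have hne : ∀ t : ℝ, δ ^ 2 + t ^ 2 ≠ 0 := fun t => by positivity
  let k : ℝ → ℝ := fun t => t / (δ ^ 2 + t ^ 2)
  -- Since `1 - γ(t) = t * k(t)`, the element `1 - γ(j)` is a multiple of `j` in the unitization,
  -- hence lies in every ideal containing `j`. Moreover `γ` is bounded by one and is small where `t`
  -- is large compared with `δ`.
  let γ : ℝ → ℝ := fun t => δ ^ 2 / (δ ^ 2 + t ^ 2)
  have hk : Continuous k := continuous_id.div (by fun_prop) hne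
  have hγ : Continuous γ := continuous_const.div (by fun_prop) hne
  have e1 : cfc γ a = 1 - a * cfc k a := by
    have : cfc γ a = cfc (fun t => 1 - t * k t) a := by
      refine cfc_congr fun t _ => ?_
      simp only [γ, k]; have := hne t; field_simp; ring
    rw [this, cfc_sub (fun _ => 1) (fun t => t * k t) a (by fun_prop) (by fun_prop),
      cfc_const_one ℝ a, cfc_mul (fun t => t) k a (by fun_prop) hk.continuousOn, cfc_id' ℝ a]
  have e2 : a * cfc k a = ((cfc k a).fst • j + j * (cfc k a).snd : X) := by
    ext <;> simp [a]
  refine ⟨(cfc k a).fst, (cfc k a).snd, ?_⟩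
  rw [← e2, ← e1]
  refine ⟨cfc_predicate _ _, norm_cfc_le zero_le_one fun t _ => ?_, ?_⟩
  · rw [Real.norm_eq_abs, abs_of_nonneg (by positivity), div_le_one (by positivity)]
    nlinarith [sq_nonneg t]
  · have e3 : cfc γ a * a * cfc γ a = cfc (fun t => t * γ t * γ t) a := by
      rw [cfc_mul (fun t => t * γ t) γ a (by fun_prop) hγ.continuousOn,
        cfc_mul (fun t => t) γ a (by fun_prop) hγ.continuousOn, cfc_id' ℝ a]
      congr 1
      have := (cfc_commute_cfc (fun t : ℝ => t) γ a).eq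
      rw [cfc_id' ℝ a] at this
      exact this.symm
    change ‖cfc γ a * a * cfc γ a‖ ≤ δ
    rw [e3]
    exact norm_cfc_le hδ.le fun t _ => abs_mul_div_sq_le hδ

namespace IsCStarIdeal

variable {X : Type*} [NonUnitalCStarAlgebra X] {J : Submodule ℂ X}

/-- For `e ∈ J` the elements `x` and `x - x * e` have the same class. With `g = 1 - e` chosen for
`j`, `‖x g‖² = ‖g (star x * x) g‖`, which is at most `‖star x * x + j‖` up to `‖g j g‖ ≤ δ`. The
infimum over `j` is the C⋆-inequality in the quotient. -/
theorem norm_mk_sq_le (h : IsCStarIdeal J) (x : X) {j : X} (hj : j ∈ J) :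
    ‖(Submodule.Quotient.mk x : X ⧸ J)‖ ^ 2 ≤ ‖star x * x + j‖ := by
  -- As `star x * x` is self-adjoint, taking the self-adjoint part of `j` takes that of the whole
  -- sum, which does not increase the norm.
  wlog hs : IsSelfAdjoint j generalizing j
  · let j' : X := (2⁻¹ : ℂ) • (j + star j)
    have hj' : j' ∈ J := J.smul_mem _ (J.add_mem hj (h.star_mem hj))
    have hs' : IsSelfAdjoint j' := by
      simp [j', IsSelfAdjoint, add_comm]
    refine (this hj' hs').trans ?_
    have : star x * x + j' = (2⁻¹ : ℂ) • ((star x * x + j) + star (star x * x + j)) := by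
      simp only [j', star_add, star_mul, star_star, smul_add]
      have : star x * x = (2⁻¹ : ℂ) • (star x * x) + (2⁻¹ : ℂ) • (star x * x) := by
        rw [← add_smul]; norm_num
      nth_rewrite 1 [this]; abel
    rw [this, norm_smul]
    calc _ ≤ ‖(2⁻¹ : ℂ)‖ * (‖star x * x + j‖ + ‖star (star x * x + j)‖) := by
          gcongr; exact norm_add_le _ _
      _ = _ := by rw [norm_star]; norm_num; ring
  refine le_of_forall_pos_le_add fun δ hδ => ?_
  obtain ⟨c, w, hg, hg1, hgj⟩ := exists_approx_unit_of_isSelfAdjoint hs hδ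
  set e : X := c • j + j * w with he
  set g : Unitization ℂ X := 1 - (e : Unitization ℂ X) with hgdef
  have heJ : e ∈ J := J.add_mem (J.smul_mem _ hj) (h.mul_right _ hj)
  have e1 : (Submodule.Quotient.mk x : X ⧸ J) = Submodule.Quotient.mk (x - x * e) := by
    rw [Submodule.Quotient.eq]; simpa using h.mul_left x heJ
  have e2 : ((x - x * e : X) : Unitization ℂ X) = x * g := by
    rw [hgdef, mul_sub, mul_one, Unitization.inr_sub, Unitization.inr_mul]
  have e3 : ‖(Submodule.Quotient.mk x : X ⧸ J)‖ ≤ ‖(x : Unitization ℂ X) * g‖ := by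
    rw [e1, ← e2, Unitization.norm_inr]; exact Submodule.Quotient.norm_mk_le _ _
  calc _ ≤ ‖(x : Unitization ℂ X) * g‖ ^ 2 := by gcongr
    _ = ‖g * ((star x * x + j : X) : Unitization ℂ X) * g - g * j * g‖ := by
        rw [sq, ← CStarRing.norm_star_mul_self, star_mul, hg.star_eq]
        congr 1
        simp only [Unitization.inr_add, Unitization.inr_mul, Unitization.inr_star]
        noncomm_ring
    _ ≤ ‖g * ((star x * x + j : X) : Unitization ℂ X) * g‖ + ‖g * j * g‖ := norm_sub_le _ _
    _ ≤ ‖star x * x + j‖ + δ := by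
        gcongr
        calc _ ≤ ‖g‖ * ‖((star x * x + j : X) : Unitization ℂ X)‖ * ‖g‖ :=
              (norm_mul_le _ _).trans (by gcongr; exact norm_mul_le _ _)
          _ ≤ 1 * ‖star x * x + j‖ * 1 := by
              rw [Unitization.norm_inr]; gcongr
          _ = _ := by ring

/-- Multiplication on the quotient by an ideal. -/
noncomputable def mulQuotient (h : IsCStarIdeal J) : (X ⧸ J) →ₗ[ℂ] (X ⧸ J) →ₗ[ℂ] (X ⧸ J) :=
  J.liftQ (LinearMap.flip (J.liftQ ((LinearMap.mul ℂ X).flip.compr₂ J.mkQ) fun j hj => by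
    ext x; simpa using h.mul_left x hj)) fun j hj => by
      refine LinearMap.ext fun y => ?_
      obtain ⟨x, rfl⟩ := Submodule.Quotient.mk_surjective J y
      exact (Submodule.Quotient.mk_eq_zero J).2 (h.mul_right x hj)

/-- The quotient of a C⋆-algebra by a closed ideal. -/
@[reducible]
noncomputable def cstarQuotient (h : IsCStarIdeal J) : NonUnitalCStarAlgebra (X ⧸ J) :=
  letI : IsClosed (J : Set X) := h.closed
  { (inferInstance : NormedAddCommGroup (X ⧸ J)), (inferInstance : NormedSpace ℂ (X ⧸ J)),
    (inferInstance : CompleteSpace (X ⧸ J)) with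
    mul := fun a b => h.mulQuotient a b
    left_distrib := fun a b c => (h.mulQuotient a).map_add b c
    right_distrib := fun a b c => h.mulQuotient.map_add₂ a b c
    zero_mul := fun a => h.mulQuotient.map_zero₂ a
    mul_zero := fun a => (h.mulQuotient a).map_zero
    mul_assoc := by
      rintro ⟨a⟩ ⟨b⟩ ⟨c⟩
      exact congrArg (Submodule.Quotient.mk (p := J)) (mul_assoc a b c)
    smul_assoc := fun c a b => h.mulQuotient.map_smul₂ c a b
    smul_comm := fun c a b => ((h.mulQuotient a).map_smul c b).symm
    norm_mul_le := by
      intro a b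
      have h1 : ∀ δ : ℝ, 0 < δ → ‖h.mulQuotient a b‖ ≤ (‖a‖ + δ) * (‖b‖ + δ) := by
        intro δ hδ
        obtain ⟨x, rfl, hx⟩ := Submodule.Quotient.norm_mk_lt a hδ
        obtain ⟨y, rfl, hy⟩ := Submodule.Quotient.norm_mk_lt b hδ
        exact (Submodule.Quotient.norm_mk_le J (x * y)).trans
          ((norm_mul_le x y).trans (mul_le_mul hx.le hy.le (norm_nonneg _) (by positivity)))
      have h2 : Filter.Tendsto (fun δ : ℝ => (‖a‖ + δ) * (‖b‖ + δ)) (𝓝[>] 0) (𝓝 (‖a‖ * ‖b‖)) := by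
        have : Continuous fun δ : ℝ => (‖a‖ + δ) * (‖b‖ + δ) := by fun_prop
        simpa using (this.tendsto 0).mono_left nhdsWithin_le_nhds
      exact ge_of_tendsto h2 (Filter.eventually_of_mem self_mem_nhdsWithin h1)
    star := Quotient.map' star fun a b hab => by
      rw [Submodule.quotientRel_def] at hab ⊢
      simpa using h.star_mem hab
    star_involutive := by
      rintro ⟨a⟩
      exact congrArg (Submodule.Quotient.mk (p := J)) (star_star a)
    star_mul := by
      rintro ⟨a⟩ ⟨b⟩
      exact congrArg (Submodule.Quotient.mk (p := J)) (star_mul a b)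
    star_add := by
      rintro ⟨a⟩ ⟨b⟩
      exact congrArg (Submodule.Quotient.mk (p := J)) (star_add a b)
    star_smul := by
      rintro c ⟨a⟩
      exact congrArg (Submodule.Quotient.mk (p := J)) (star_smul c a)
    norm_mul_self_le := by
      rintro ⟨x⟩
      refine le_of_forall_pos_le_add fun δ hδ => ?_
      obtain ⟨y, hy, hyn⟩ := Submodule.Quotient.norm_mk_lt
        (Submodule.Quotient.mk (star x * x) : X ⧸ J) hδ
      have h1 := h.norm_mk_sq_le x ((Submodule.Quotient.eq J).1 hy)
      rw [add_sub_cancel, sq] at h1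
      exact h1.trans hyn.le }

/-- The quotient map as a `*`-homomorphism. -/
noncomputable def mkHom (h : IsCStarIdeal J) :
    letI := h.cstarQuotient
    X →⋆ₙₐ[ℂ] (X ⧸ J) :=
  letI := h.cstarQuotient
  { toFun := Submodule.Quotient.mk
    map_smul' := fun _ _ => rfl
    map_zero' := rfl
    map_add' := fun _ _ => rfl
    map_mul' := fun _ _ => rfl
    map_star' := fun _ => rfl }

end IsCStarIdeal

/-! ### Kernels and ranges of `*`-homomorphisms -/

section StarHom

variable {X Y : Type*} [NonUnitalCStarAlgebra X] [NonUnitalCStarAlgebra Y]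

theorem isCStarIdeal_ker (φ : X →⋆ₙₐ[ℂ] Y) : IsCStarIdeal (LinearMap.ker (φ : X →ₗ[ℂ] Y)) where
  closed := isClosed_eq (ExoticCrossedProduct.continuous_starHom φ) continuous_const
  mul_left x j hj := by
    have : φ j = 0 := hj
    change φ (x * j) = 0
    simp [this]
  mul_right {j} x hj := by
    have : φ j = 0 := hj
    change φ (j * x) = 0
    simp [this]
  star_mem {j} hj := by
    have : φ j = 0 := hj
    change φ (star j) = 0
    simp [map_star, this]

/-- A `*`-homomorphism is isometric modulo its kernel. -/
theorem norm_mk_ker (φ : X →⋆ₙₐ[ℂ] Y) (x : X) :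
    ‖(Submodule.Quotient.mk x : X ⧸ LinearMap.ker (φ : X →ₗ[ℂ] Y))‖ = ‖φ x‖ := by
  have h := isCStarIdeal_ker φ
  let _ := h.cstarQuotient
  -- The quotient is a C⋆-algebra, and injective `*`-homomorphisms of C⋆-algebras are isometric.
  let ψ : (X ⧸ LinearMap.ker (φ : X →ₗ[ℂ] Y)) →⋆ₙₐ[ℂ] Y :=
    { (LinearMap.ker (φ : X →ₗ[ℂ] Y)).liftQ (φ : X →ₗ[ℂ] Y) le_rfl with
      map_zero' := map_zero φ
      map_mul' := by rintro ⟨a⟩ ⟨b⟩; exact map_mul φ a b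
      map_star' := by rintro ⟨a⟩; exact map_star φ a }
  have hψ : Function.Injective ψ :=
    LinearMap.ker_eq_bot.1 (Submodule.ker_liftQ_eq_bot _ _ _ le_rfl)
  exact (NonUnitalStarAlgHom.norm_map ψ hψ (Submodule.Quotient.mk x)).symm

theorem exists_preimage_norm_lt (φ : X →⋆ₙₐ[ℂ] Y) (x : X) {ε : ℝ} (hε : 0 < ε) :
    ∃ x', φ x' = φ x ∧ ‖x'‖ < ‖φ x‖ + ε := by
  obtain ⟨x', hx', hn⟩ := Submodule.Quotient.norm_mk_lt
    (Submodule.Quotient.mk x : X ⧸ LinearMap.ker (φ : X →ₗ[ℂ] Y)) hε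
  rw [norm_mk_ker] at hn
  refine ⟨x', ?_, hn⟩
  have h1 : φ (x' - x) = 0 := (Submodule.Quotient.eq _).1 hx'
  rwa [map_sub, sub_eq_zero] at h1

/-- `*`-homomorphisms between C⋆-algebras have closed range. -/
theorem isClosed_range_starHom (φ : X →⋆ₙₐ[ℂ] Y) : IsClosed (Set.range φ) := by
  let K := LinearMap.ker (φ : X →ₗ[ℂ] Y)
  have h := isCStarIdeal_ker φ
  let ψ : (X ⧸ K) →ₗ[ℂ] Y := K.liftQ (φ : X →ₗ[ℂ] Y) le_rfl
  have : IsClosed (K : Set X) := h.closed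
  have hψ : Isometry ψ := AddMonoidHomClass.isometry_of_norm ψ (by
    rintro ⟨x⟩; exact (norm_mk_ker φ x).symm)
  have : Set.range φ = Set.range ψ := by
    ext y; constructor
    · rintro ⟨x, rfl⟩; exact ⟨Submodule.Quotient.mk x, rfl⟩
    · rintro ⟨⟨x⟩, rfl⟩; exact ⟨x, rfl⟩
  rw [this]
  exact hψ.isClosedEmbedding.isClosed_range

/-- Closedness of the range reduces each lifting problem below to approximate lifting. -/
theorem surjective_of_denseRange (φ : X →⋆ₙₐ[ℂ] Y) (h : DenseRange φ) : Function.Surjective φ := by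
  rw [← Set.range_eq_univ, ← (isClosed_range_starHom φ).closure_eq]
  exact h.closure_range

end StarHom

/-! ### Lifting compactly supported functions -/

/-- Post-composition of continuous functions on a compact space with a `*`-homomorphism. -/
def compStarHom (K : Type*) [TopologicalSpace K] [CompactSpace K] {X Y : Type*}
    [NonUnitalCStarAlgebra X] [NonUnitalCStarAlgebra Y] (φ : X →⋆ₙₐ[ℂ] Y) :
    C(K, X) →⋆ₙₐ[ℂ] C(K, Y) where
  toFun f := ⟨fun t => φ (f t),
    (ExoticCrossedProduct.continuous_starHom φ).comp f.continuous⟩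
  map_smul' c f := by ext t; exact map_smul φ c (f t)
  map_zero' := by ext t; exact map_zero φ
  map_add' f g := by ext t; exact map_add φ (f t) (g t)
  map_mul' f g := by ext t; exact map_mul φ (f t) (g t)
  map_star' f := by ext t; exact map_star φ (f t)

/-- Near each point a constant is an approximate lift, and approximate lifts form convex sets, so a
partition of unity glues the constants to a continuous approximate lift. Closed range makes it
exact. -/
theorem compStarHom_surjective {K : Type*} [TopologicalSpace K] [CompactSpace K] [T2Space K]
    {X Y : Type*} [NonUnitalCStarAlgebra X] [NonUnitalCStarAlgebra Y] (φ : X →⋆ₙₐ[ℂ] Y)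
    (hφ : Function.Surjective φ) : Function.Surjective (compStarHom K φ) := by
  refine surjective_of_denseRange _ fun f => Metric.mem_closure_iff.2 fun ε hε => ?_
  let T : K → Set X := fun x => {c | ‖φ c - f x‖ < ε / 2}
  have hconv : ∀ x, Convex ℝ (T x) := fun x => by
    have : T x = ((φ : X →ₗ[ℂ] Y).restrictScalars ℝ) ⁻¹' Metric.ball (f x) (ε / 2) := by
      ext c; simp [T, dist_eq_norm]
    rw [this]
    exact (convex_ball _ _).linear_preimage _
  have hloc : ∀ x, ∃ c, ∀ᶠ y in 𝓝 x, c ∈ T y := fun x => by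
    obtain ⟨c, hc⟩ := hφ (f x)
    refine ⟨c, ?_⟩
    have h1 : Continuous fun y => ‖φ c - f y‖ := by fun_prop
    have h2 : Filter.Tendsto (fun y => ‖φ c - f y‖) (𝓝 x) (𝓝 0) := by
      have := h1.tendsto x
      rwa [show ‖φ c - f x‖ = 0 by rw [hc, sub_self, norm_zero]] at this
    exact h2.eventually_lt_const (half_pos hε)
  obtain ⟨g, hg⟩ := exists_continuous_forall_mem_convex_of_local_const hconv hloc
  refine ⟨_, ⟨g, rfl⟩, ?_⟩
  rw [dist_comm]
  refine lt_of_le_of_lt ((ContinuousMap.dist_le (by positivity)).2 fun x => ?_) (half_lt_self hε)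
  rw [dist_eq_norm]
  exact (hg x).le

/-! ### Cut-off functions and extension by zero from compact sets -/

section Cutoff

variable {G : Type*} [TopologicalSpace G]

/-- A compactly supported cut-off function, with its support in the interior of the compact set
`K`. -/
structure Cutoff (K : Set G) where
  χ : C_c(G, ℝ)
  compact : IsCompact K
  tsupport_subset : tsupport χ ⊆ interior K
  mem_Icc : ∀ t, χ t ∈ Set.Icc (0 : ℝ) 1

theorem exists_cutoff [LocallyCompactSpace G] [T2Space G] {S : Set G} (hS : IsCompact S) :
    ∃ (K : Set G) (c : Cutoff K), S ⊆ K ∧ ∀ t ∈ S, c.χ t = 1 := by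
  obtain ⟨K, hK, hSK⟩ := exists_compact_superset hS
  obtain ⟨χ, h1, h2, h3, h4⟩ := exists_continuousMap_one_of_isCompact_subset_isOpen hS
    isOpen_interior hSK
  exact ⟨K, ⟨⟨χ, h2⟩, hK, h3, h4⟩, hSK.trans interior_subset, fun t ht => h1 ht⟩

variable {K : Set G} {E : Type*} [NormedAddCommGroup E] [NormedSpace ℂ E]

open Classical in
/-- The extension of a continuous function on `K`, multiplied by a cut-off function, to a compactly
supported function. -/
noncomputable def Cutoff.extend (c : Cutoff K) : C(K, E) →ₗ[ℂ] C_c(G, E) where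
  toFun f :=
    { toFun := fun t => if h : t ∈ K then (c.χ t : ℂ) • f ⟨t, h⟩ else 0
      continuous_toFun := by
        rw [continuous_iff_continuousAt]
        intro t
        by_cases ht : t ∈ tsupport c.χ
        · have hK : K ∈ 𝓝 t := mem_interior_iff_mem_nhds.1 (c.tsupport_subset ht)
          refine ContinuousOn.continuousAt (s := K) ?_ hK
          rw [continuousOn_iff_continuous_domRestrict]
          have : Continuous fun s : K => (c.χ s : ℂ) • f s :=
            (Complex.continuous_ofReal.comp (c.χ.continuous.comp continuous_subtype_val)).smul
              f.continuous
          convert this using 2 with s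
          simp [s.2]
        · have h0 : (fun t => if h : t ∈ K then (c.χ t : ℂ) • f ⟨t, h⟩ else 0) =ᶠ[𝓝 t]
              fun _ => 0 := by
            filter_upwards [(isClosed_tsupport c.χ).isOpen_compl.mem_nhds ht] with s hs
            have : c.χ s = 0 := image_eq_zero_of_notMem_tsupport hs
            simp [this]
          exact continuousAt_const.congr h0.symm
      hasCompactSupport' := by
        refine HasCompactSupport.intro' c.χ.hasCompactSupport.isCompact
          (isClosed_tsupport _) fun t ht => ?_
        have : c.χ t = 0 := image_eq_zero_of_notMem_tsupport ht
        simp [this] }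
  map_add' f g := by
    ext t
    by_cases h : t ∈ K <;> simp [h]
  map_smul' a f := by
    ext t
    by_cases h : t ∈ K <;> simp [h, smul_comm a]

theorem Cutoff.extend_apply (c : Cutoff K) (f : C(K, E)) {t : G} (ht : t ∈ K) :
    c.extend f t = (c.χ t : ℂ) • f ⟨t, ht⟩ := dif_pos ht

theorem Cutoff.extend_apply_of_notMem (c : Cutoff K) (f : C(K, E)) {t : G} (ht : t ∉ K) :
    c.extend f t = 0 := dif_neg ht

theorem Cutoff.norm_extend_le [CompactSpace K] (c : Cutoff K) (f : C(K, E)) (t : G) :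
    ‖c.extend f t‖ ≤ c.χ t * ‖f‖ := by
  have h0 := (c.mem_Icc t).1
  by_cases ht : t ∈ K
  · rw [c.extend_apply f ht, norm_smul, Complex.norm_real, Real.norm_of_nonneg h0]
    exact mul_le_mul_of_nonneg_left (f.norm_coe_le_norm _) h0
  · rw [c.extend_apply_of_notMem f ht, norm_zero]
    exact mul_nonneg h0 (norm_nonneg f)

theorem Cutoff.extend_restrict (c : Cutoff K) (f : C_c(G, E)) {S : Set G} (hSK : S ⊆ K)
    (hS : ∀ t ∈ S, c.χ t = 1) (hf : ∀ t, t ∉ S → f t = 0) :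
    c.extend (f.toContinuousMap.restrict K) = f := by
  ext t
  by_cases ht : t ∈ S
  · rw [c.extend_apply _ (hSK ht), hS t ht]; simp
  · by_cases htK : t ∈ K
    · rw [c.extend_apply _ htK]; simp [hf t ht]
    · rw [c.extend_apply_of_notMem _ htK, hf t ht]

end Cutoff

namespace ExoticCrossedProduct

universe u

/-! ### Operations on `C_c(G, A)` -/

section Pushforward

variable {G : Type u} [Group G] [TopologicalSpace G] {A B C : GAlgebra G}

@[simp]
theorem pushforward_apply (φ : GHom A B) (f : C_c(G, A)) (t : G) :
    pushforward φ f t = φ (f t) := rfl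

/-- `pushforward` as a linear map. -/
def pushforwardₗ (φ : GHom A B) : C_c(G, A) →ₗ[ℂ] C_c(G, B) where
  toFun := pushforward φ
  map_add' f g := by ext t; exact map_add φ.toHom (f t) (g t)
  map_smul' c f := by ext t; exact map_smul φ.toHom c (f t)

theorem pushforward_comp (ψ : GHom B C) (φ : GHom A B) (f : C_c(G, A)) :
    pushforward (ψ.comp φ) f = pushforward ψ (pushforward φ f) := rfl

theorem mem_ccIn_ker_iff (φ : GHom A B) (f : C_c(G, A)) :
    f ∈ ccIn (LinearMap.ker (φ.toHom : A →ₗ[ℂ] B)) ↔ pushforward φ f = 0 :=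
  ⟨fun h => by ext t; exact h t, fun h t => DFunLike.congr_fun h t⟩

/-- Compactly supported functions lift along surjections. -/
theorem pushforward_surjective [LocallyCompactSpace G] [T2Space G] (φ : GHom A B)
    (hφ : Function.Surjective φ) : Function.Surjective (pushforward φ) := by
  intro f
  obtain ⟨K, c, hSK, hc⟩ := exists_cutoff f.hasCompactSupport.isCompact
  have := isCompact_iff_compactSpace.1 c.compact
  -- The lift over `K` need not vanish at the boundary of `K`. Multiplying by the cut-off repairs
  -- this without changing its image, since the cut-off is one on the support of `f`.
  obtain ⟨g, hg⟩ := compStarHom_surjective (K := K) φ.toHom hφ (f.toContinuousMap.restrict K)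
  refine ⟨c.extend g, ?_⟩
  rw [← c.extend_restrict f hSK hc fun t ht => image_eq_zero_of_notMem_tsupport ht, ← hg]
  ext t
  by_cases ht : t ∈ K
  · rw [pushforward_apply, c.extend_apply _ ht, c.extend_apply _ ht]
    exact map_smul φ.toHom _ _
  · rw [pushforward_apply, c.extend_apply_of_notMem _ ht, c.extend_apply_of_notMem _ ht]
    exact map_zero φ.toHom

end Pushforward

section Operators

variable {G : Type u} [Group G] [TopologicalSpace G] {A : GAlgebra G}

/-- Pointwise multiplication by `a` from the left. -/
def leftMul (a : A) : C_c(G, A) →ₗ[ℂ] C_c(G, A) where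
  toFun f :=
    { toFun := fun t => a * f t
      continuous_toFun := continuous_const.mul f.continuous
      hasCompactSupport' := f.hasCompactSupport.comp_left (g := fun x => a * x) (mul_zero a) }
  map_add' f g := by ext t; exact mul_add a (f t) (g t)
  map_smul' c f := by ext t; exact mul_smul_comm c a (f t)

@[simp]
theorem leftMul_apply (a : A) (f : C_c(G, A)) (t : G) : leftMul a f t = a * f t := rfl

variable [IsTopologicalGroup G]

/-- The translation `f ↦ α_g(f(g⁻¹ ·))`. -/
def translate (g : G) : C_c(G, A) →ₗ[ℂ] C_c(G, A) where
  toFun f :=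
    { toFun := fun t => A.act g (f (g⁻¹ * t))
      continuous_toFun := A.continuous_act_uncurry.comp
        (continuous_const.prodMk (f.continuous.comp (continuous_const.mul continuous_id)))
      hasCompactSupport' :=
        (f.hasCompactSupport.comp_homeomorph (Homeomorph.mulLeft g⁻¹)).comp_left
          (g := fun x => A.act g x) (map_zero (A.act g)) }
  map_add' f h := by ext t; exact map_add (A.act g) (f (g⁻¹ * t)) (h (g⁻¹ * t))
  map_smul' c f := by ext t; exact map_smul (A.act g) c (f (g⁻¹ * t))

@[simp]
theorem translate_apply (g : G) (f : C_c(G, A)) (t : G) :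
    translate g f t = A.act g (f (g⁻¹ * t)) := rfl

theorem translate_one (f : C_c(G, A)) : translate 1 f = f := by
  ext t; simp

theorem translate_mul (g h : G) (f : C_c(G, A)) :
    translate (g * h) f = translate g (translate h f) := by
  ext t; simp [mul_assoc]

theorem translate_leftMul (g : G) (a : A) (f : C_c(G, A)) :
    translate g (leftMul a f) = leftMul (A.act g a) (translate g f) := by
  ext t; simp

theorem continuous_conv_integrand (f g : C_c(G, A)) :
    Continuous fun p : G × G => f p.1 * A.act p.1 (g (p.1⁻¹ * p.2)) :=
  (f.continuous.comp continuous_fst).mul (A.continuous_act_uncurry.comp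
    (continuous_fst.prodMk (g.continuous.comp (by fun_prop))))

end Operators

/-! ### Convolution, involution and their behaviour under the operators -/

section Convolution

variable {G : Type u} [Group G] [TopologicalSpace G] [IsTopologicalGroup G]
  [LocallyCompactSpace G] {A B : GAlgebra G}

theorem involution_apply (f : C_c(G, A)) (t : G) : involution f t =
    ((Measure.modularCharacter t : ℝ) : ℂ) • star (A.act t (f t⁻¹)) := rfl

theorem involution_zero : involution (0 : C_c(G, A)) = 0 := by
  ext t; simp [involution_apply]

theorem pushforward_involution (φ : GHom A B) (f : C_c(G, A)) :
    pushforward φ (involution f) = involution (pushforward φ f) := by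
  ext t
  simp only [pushforward_apply, involution_apply]
  rw [map_smul, map_star, φ.map_act]

variable [MeasurableSpace G] [BorelSpace G]

theorem map_mul_right_haar (g : G) : Measure.map (· * g) (Measure.haar : Measure G) =
    Measure.modularCharacter g • (Measure.haar : Measure G) := by
  have : Measure.Regular (Measure.map (· * g) (Measure.haar : Measure G)) :=
    Measure.Regular.map (Homeomorph.mulRight g)
  have h := Measure.isMulLeftInvariant_eq_smul_of_regular
    (Measure.map (· * g) (Measure.haar : Measure G)) Measure.haar
  rwa [← Measure.modularCharacterFun_eq_haarScalarFactor] at h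

theorem integral_mul_right_haar {E : Type*} [NormedAddCommGroup E] [NormedSpace ℝ E]
    (F : G → E) (g : G) : ∫ s, F (s * g) ∂Measure.haar =
      (Measure.modularCharacter g : ℝ) • ∫ s, F s ∂(Measure.haar : Measure G) := by
  have h := (Homeomorph.mulRight g).measurableEmbedding.integral_map
    (μ := (Measure.haar : Measure G)) F
  simp only [Homeomorph.coe_mulRight] at h
  rw [← h, map_mul_right_haar, integral_smul_nnreal_measure]
  rfl

theorem conv_apply (f g : C_c(G, A)) (t : G) :
    conv f g t = ∫ s, f s * A.act s (g (s⁻¹ * t)) ∂Measure.haar := rfl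

theorem integrable_conv_integrand (f g : C_c(G, A)) (t : G) :
    Integrable (fun s => f s * A.act s (g (s⁻¹ * t))) (Measure.haar : Measure G) := by
  refine Continuous.integrable_of_hasCompactSupport
    ((continuous_conv_integrand f g).comp (continuous_id.prodMk continuous_const)) ?_
  exact f.hasCompactSupport.mono fun s hs h => hs (by simp [h])

theorem conv_zero_left (g : C_c(G, A)) : conv 0 g = 0 := by
  ext t; simp [conv_apply]

theorem conv_zero_right (f : C_c(G, A)) : conv f 0 = 0 := by
  ext t; simp [conv_apply]

theorem pushforward_conv (φ : GHom A B) (f g : C_c(G, A)) :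
    pushforward φ (conv f g) = conv (pushforward φ f) (pushforward φ g) := by
  ext t
  let L : A →L[ℂ] B := ⟨(φ.toHom : A →ₗ[ℂ] B), φ.continuous⟩
  have h := L.integral_comp_comm (integrable_conv_integrand f g t)
  refine h.symm.trans (integral_congr_ae (Filter.Eventually.of_forall fun s => ?_))
  change φ.toHom (f s * A.act s (g (s⁻¹ * t))) = φ.toHom (f s) * B.act s (φ.toHom (g (s⁻¹ * t)))
  rw [map_mul, φ.map_act]

/-- With `f^* * h` viewed as an inner product, left multiplication by `star a` is the adjoint of
left multiplication by `a`. -/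
theorem conv_involution_leftMul (a : A) (f h : C_c(G, A)) :
    conv (involution (leftMul a f)) h = conv (involution f) (leftMul (star a) h) := by
  ext t
  simp only [conv_apply, involution_apply, leftMul_apply, map_mul, star_mul, map_star,
    smul_mul_assoc, mul_assoc]

/-- Translations are unitary for the inner product `f^* * h`. The integrand for the translates is
the original one at `s * g` divided by the modular character of `g`, and right translation of the
Haar integral restores this factor. -/
theorem conv_involution_translate (g : G) (f h : C_c(G, A)) :
    conv (involution (translate g f)) (translate g h) = conv (involution f) h := by
  ext t
  simp only [conv_apply]
  let F : G → A := fun s => involution f s * A.act s (h (s⁻¹ * t))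
  have hg : (Measure.modularCharacter g : ℝ) ≠ 0 :=
    NNReal.coe_ne_zero.2 (Measure.modularCharacterFun_pos g).ne'
  have key : ∀ s, involution (translate g f) s * A.act s (translate g h (s⁻¹ * t)) =
      (Measure.modularCharacter g : ℝ)⁻¹ • F (s * g) := by
    intro s
    simp only [F, involution_apply, translate_apply, mul_inv_rev, map_mul, smul_mul_assoc,
      StarAlgEquiv.mul_apply, mul_assoc]
    rw [← Complex.coe_smul, smul_smul]
    congr 1
    push_cast
    rw [mul_comm, mul_assoc, mul_inv_cancel₀ (by exact_mod_cast hg), mul_one]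
  simp only [key]
  rw [integral_smul, integral_mul_right_haar, smul_smul, inv_mul_cancel₀ hg, one_smul]

end Convolution

end ExoticCrossedProduct

/-! ### Square roots and positive functionals in C⋆-algebras -/

/-- A square root of `‖a‖² - a^* a`, of the form `‖a‖ + b`. -/
theorem exists_sqrt_norm_sq_sub {X : Type*} [NonUnitalCStarAlgebra X] (a : X) :
    ∃ b : X, IsSelfAdjoint b ∧ b * b + (2 * ‖a‖) • b = -(star a * a) := by
  let z : X := star a * a
  have hz : IsSelfAdjoint z := .star_mul_self a
  -- Subtracting `‖a‖` makes the function vanish at zero, so the non-unital functional calculus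
  -- keeps `b` in `X`. Formally `(‖a‖ + b)² = ‖a‖² - star a * a`.
  let f : ℝ → ℝ := fun t => √(‖a‖ ^ 2 - t) - ‖a‖
  have hf : Continuous f := by fun_prop
  have hf0 : f 0 = 0 := by simp [f]
  refine ⟨cfcₙ f z, cfcₙ_predicate _ _, ?_⟩
  have e1 : (2 * ‖a‖) • cfcₙ f z = cfcₙ (fun t => (2 * ‖a‖) • f t) z :=
    (cfcₙ_smul (2 * ‖a‖) f z).symm
  rw [← cfcₙ_mul f f z, e1, ← cfcₙ_add (a := z) (fun t => f t * f t) (fun t => (2 * ‖a‖) • f t)]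
  · have e2 : cfcₙ (fun t => f t * f t + (2 * ‖a‖) • f t) z = cfcₙ (fun t : ℝ => -t) z := by
      refine cfcₙ_congr fun t ht => ?_
      have ht' : t ≤ ‖a‖ ^ 2 := by
        have h1 := norm_apply_le_norm_cfcₙ (fun t : ℝ => t) z ht
        rw [cfcₙ_id' ℝ z, CStarRing.norm_star_mul_self, ← sq] at h1
        exact (le_abs_self t).trans h1
      have h2 := Real.sq_sqrt (sub_nonneg.2 ht')
      simp only [f, smul_eq_mul]
      nlinarith
    rw [e2, cfcₙ_neg (fun t : ℝ => t) z, cfcₙ_id' ℝ z]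

/-- Evaluating at `x + i t` gives `(Im F(x) + t)² ≤ ‖x‖² + t²` for all real `t`. The terms `t²`
cancel, and the remaining term linear in `t` must vanish. -/
theorem im_apply_eq_zero_of_isSelfAdjoint {U : Type*} [CStarAlgebra U] {F : StrongDual ℂ U} (hF : ‖F‖ ≤ 1) (hF1 : F 1 = 1)
    {x : U} (hx : IsSelfAdjoint x) : (F x).im = 0 := by
  have key : ∀ t : ℝ, (F x).im ^ 2 + 2 * (F x).im * t ≤ ‖x‖ ^ 2 := by
    intro t
    let y : U := x + ((t : ℂ) * Complex.I) • (1 : U)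
    have h1 : F y = F x + (t : ℂ) * Complex.I := by simp [y, hF1]
    have h2 : ‖y‖ ^ 2 ≤ ‖x‖ ^ 2 + t ^ 2 := by
      have e : star y * y = x * x + ((t ^ 2 : ℝ) : ℂ) • (1 : U) := by
        simp only [y, star_add, hx.star_eq, star_smul, star_one, mul_add, add_mul, smul_mul_assoc,
          mul_smul_comm, one_mul, mul_one]
        have : star ((t : ℂ) * Complex.I) = -((t : ℂ) * Complex.I) := by simp
        rw [this]
        have h3 : ((t ^ 2 : ℝ) : ℂ) = ((t : ℂ) * Complex.I) * -((t : ℂ) * Complex.I) := by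
          push_cast; linear_combination ((t : ℂ) ^ 2) * Complex.I_sq
        rw [h3]
        module
      rw [sq, ← CStarRing.norm_star_mul_self, e]
      refine (norm_add_le _ _).trans (add_le_add ?_ ?_)
      · rw [sq]; exact norm_mul_le _ _
      · rw [norm_smul, Complex.norm_real, Real.norm_of_nonneg (sq_nonneg t)]
        rcases subsingleton_or_nontrivial U with _ | _
        · rw [Subsingleton.elim (1 : U) 0, norm_zero, mul_zero]; positivity
        · simp
    have h3 : ‖F y‖ ^ 2 ≤ ‖y‖ ^ 2 := by
      gcongr; simpa using F.le_of_opNorm_le hF y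
    rw [h1, Complex.sq_norm, Complex.normSq_apply] at h3
    simp at h3
    nlinarith [sq_nonneg (F x).re]
  by_contra h
  have := key ((‖x‖ ^ 2 + 1) / (2 * (F x).im))
  rw [mul_div_cancel₀ _ (mul_ne_zero two_ne_zero h)] at this
  nlinarith [sq_nonneg (F x).im]

section State

variable {U : Type*} [CStarAlgebra U] [PartialOrder U] [StarOrderedRing U]

/-- Positivity of `x` gives `‖‖x‖ - x‖ ≤ ‖x‖`, so `F x` lies in the disc of radius `‖x‖` around
`‖x‖`. -/
theorem apply_nonneg_of_norm_le_one {F : StrongDual ℂ U} (hF : ‖F‖ ≤ 1) (hF1 : F 1 = 1)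
    {x : U} (hx : 0 ≤ x) : 0 ≤ (F x).re := by
  have hle : x ≤ algebraMap ℝ U ‖x‖ := IsSelfAdjoint.le_algebraMap_norm_self hx.isSelfAdjoint
  have h1 : ‖algebraMap ℝ U ‖x‖ - x‖ ≤ ‖x‖ :=
    (CStarAlgebra.norm_le_iff_le_algebraMap _ (norm_nonneg x) (sub_nonneg.2 hle)).2
      (sub_le_self _ hx)
  have h2 : ‖F (algebraMap ℝ U ‖x‖ - x)‖ ≤ ‖x‖ :=
    (F.le_of_opNorm_le hF _).trans (by simpa using h1)
  have h3 : F (algebraMap ℝ U ‖x‖ - x) = ‖x‖ - F x := by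
    rw [map_sub, Algebra.algebraMap_eq_smul_one, ← Complex.coe_smul, map_smul, hF1]; simp
  rw [h3] at h2
  have h4 := (Complex.re_le_norm _).trans h2
  simp at h4
  exact h4

/-- Because of this additivity, a norm-one functional that norms `1 + z` must norm `1` and `z`
separately. It is thus a state that norms `z`. -/
theorem norm_one_add_of_nonneg [Nontrivial U] {z : U} (hz : 0 ≤ z) : ‖1 + z‖ = 1 + ‖z‖ := by
  refine le_antisymm (by simpa using norm_add_le (1 : U) z) ?_
  have h1 : 1 ≤ ‖1 + z‖ := by
    simpa using CStarAlgebra.norm_le_norm_of_nonneg_of_le (a := (1 : U)) (b := 1 + z) zero_le_one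
      (le_add_of_nonneg_right hz)
  have h2 : 1 + z ≤ algebraMap ℝ U ‖1 + z‖ :=
    IsSelfAdjoint.le_algebraMap_norm_self (add_nonneg zero_le_one hz).isSelfAdjoint
  have h3 : z ≤ algebraMap ℝ U (‖1 + z‖ - 1) := by
    rw [map_sub, map_one]; exact le_sub_iff_add_le'.2 h2
  have h4 := (CStarAlgebra.norm_le_iff_le_algebraMap z (sub_nonneg.2 h1) hz).2 h3
  linarith

end State

open scoped ComplexOrder in
/-- Norming positive functionals. -/
theorem exists_positive_functional {X : Type*} [NonUnitalCStarAlgebra X] [PartialOrder X]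
    [StarOrderedRing X] {z : X} (hz : 0 ≤ z) :
    ∃ φ : X →ₚ[ℂ] ℂ, (∀ x, ‖φ x‖ ≤ ‖x‖) ∧ φ z = ‖z‖ := by
  let U := Unitization ℂ X
  let _ : PartialOrder U := CStarAlgebra.spectralOrder U
  let _ : StarOrderedRing U := CStarAlgebra.spectralOrderedRing U
  have hz' : (0 : U) ≤ z := Unitization.inr_nonneg_iff.2 hz
  have hn := norm_one_add_of_nonneg hz'
  have hzn : ‖(z : U)‖ = ‖z‖ := Unitization.norm_inr z
  obtain ⟨F, hF, hFz⟩ := exists_dual_vector ℂ (1 + (z : U)) (by rw [hn]; positivity)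
  have h1 : ‖F 1‖ ≤ 1 := by simpa [hF] using F.le_opNorm 1
  have h2 : ‖F z‖ ≤ ‖z‖ := by simpa [hF, hzn] using F.le_opNorm z
  rw [hn, map_add, hzn] at hFz
  have hre := congrArg Complex.re hFz
  have him := congrArg Complex.im hFz
  simp at hre him
  have r1 := (Complex.re_le_norm _).trans h1
  have r2 := (Complex.re_le_norm _).trans h2
  have e1 : (F 1).re = 1 := by linarith
  have hF1 : F 1 = 1 := by
    have : (F 1).im = 0 := by
      have h := Complex.sq_norm (F 1)
      rw [Complex.normSq_apply, e1] at h
      have : ‖F 1‖ ^ 2 ≤ 1 := pow_le_one₀ (norm_nonneg _) h1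
      nlinarith
    exact Complex.ext (by simpa using e1) (by simpa using this)
  have hpos : ∀ x : X, 0 ≤ x → 0 ≤ F x := fun x hx => by
    have hx' : (0 : U) ≤ x := Unitization.inr_nonneg_iff.2 hx
    refine Complex.nonneg_iff.2 ⟨apply_nonneg_of_norm_le_one hF.le hF1 hx', ?_⟩
    exact (im_apply_eq_zero_of_isSelfAdjoint hF.le hF1 hx'.isSelfAdjoint).symm
  let φ₀ : X →ₗ[ℂ] ℂ := (F : U →ₗ[ℂ] ℂ).comp (Unitization.inrNonUnitalStarAlgHom ℂ X : X →ₗ[ℂ] U)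
  refine ⟨PositiveLinearMap.mk₀ φ₀ hpos, fun x => ?_, ?_⟩
  · change ‖F x‖ ≤ ‖x‖
    simpa [hF, Unitization.norm_inr] using F.le_opNorm x
  · change F z = ‖z‖
    rw [hF1] at hFz
    push_cast at hFz
    exact add_left_cancel hFz

open scoped Pointwise

namespace ExoticCrossedProduct

universe u

/-! ### Covariant representations from Hilbert space valued maps on `C_c(G, A)` -/

variable {G : Type u} [Group G] [TopologicalSpace G]

/-- A linear map on `C_c(G, A)` is locally bounded if it is bounded for the supremum norm on the
functions supported in a fixed compact set. -/
def LocallyBounded {A : GAlgebra G} {E : Type*} [NormedAddCommGroup E] [NormedSpace ℂ E]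
    (v : C_c(G, A) →ₗ[ℂ] E) : Prop :=
  ∀ (K : Set G) [CompactSpace K] (c : Cutoff K), ∃ M : ℝ, ∀ f : C(K, A),
    ‖v (c.extend f)‖ ≤ M * ‖f‖

theorem LocallyBounded.exists_clm {A : GAlgebra G} {E : Type*} [NormedAddCommGroup E]
    [NormedSpace ℂ E] {v : C_c(G, A) →ₗ[ℂ] E} (hv : LocallyBounded v) {K : Set G} [CompactSpace K]
    (c : Cutoff K) : ∃ T : C(K, A) →L[ℂ] E, ∀ f, T f = v (c.extend f) := by
  obtain ⟨M, hM⟩ := hv K c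
  exact ⟨(v.comp c.extend).mkContinuous M hM, fun f => rfl⟩

/-- If the slices of a continuous function on `G × G` are supported in the set on which the cut-off
function is one, then a locally bounded map is given on the slices by a continuous linear map. -/
theorem LocallyBounded.exists_slices {A : GAlgebra G} {E : Type*} [NormedAddCommGroup E]
    [NormedSpace ℂ E] {v : C_c(G, A) →ₗ[ℂ] E} (hv : LocallyBounded v)
    [LocallyCompactSpace G] [T2Space G] {S : Set G} (hS : IsCompact S) (Φ : C(G × G, A)) :
    ∃ (K : Set G) (_ : CompactSpace K) (T : C(K, A) →L[ℂ] E) (F : C(G, C(K, A))),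
      (∀ s t, F s t = Φ (s, (t : G))) ∧
      ∀ (f : C_c(G, A)), (∀ t, t ∉ S → f t = 0) →
        T (f.toContinuousMap.restrict K) = v f := by
  obtain ⟨K, c, hSK, hc⟩ := exists_cutoff hS
  have hK := isCompact_iff_compactSpace.1 c.compact
  obtain ⟨T, hT⟩ := hv.exists_clm c
  refine ⟨K, hK, T, ContinuousMap.curry
    (Φ.comp ⟨fun p : G × K => (p.1, (p.2 : G)), by fun_prop⟩), fun s t => rfl, fun f hf => ?_⟩
  rw [hT, c.extend_restrict f hSK hc hf]

variable [IsTopologicalGroup G]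

/-- A densely defined Hilbert space valued map on `C_c(G, A)` whose inner product is compatible
with the operations of `A` and `G`. -/
structure PreRep (A : GAlgebra G) where
  H : Type u
  [normed : NormedAddCommGroup H]
  [inner : InnerProductSpace ℂ H]
  [complete : CompleteSpace H]
  v : C_c(G, A) →ₗ[ℂ] H
  dense : DenseRange v
  inner_leftMul : ∀ (a : A) (f h : C_c(G, A)),
    Inner.inner ℂ (v (leftMul a f)) (v h) = Inner.inner ℂ (v f) (v (leftMul (star a) h))
  inner_translate : ∀ (g : G) (f h : C_c(G, A)),
    Inner.inner ℂ (v (translate g f)) (v (translate g h)) = Inner.inner ℂ (v f) (v h)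
  locallyBounded : LocallyBounded v

attribute [instance] PreRep.normed PreRep.inner PreRep.complete

namespace PreRep

variable {A : GAlgebra G} (P : PreRep A)

theorem clm_ext {S T : P.H →L[ℂ] P.H} (h : ∀ f, S (P.v f) = T (P.v f)) : S = T :=
  DFunLike.coe_injective (P.dense.equalizer S.continuous T.continuous (funext h))

/-- No boundedness is known in advance, so positivity is made algebraic. The operator `B = ‖a‖ + b`
is symmetric with `B² = ‖a‖² - star a * a`, whence `0 ≤ ‖v(B f)‖² = ‖a‖² ‖v f‖² - ‖v(a f)‖²`. -/
theorem norm_leftMul_le (a : A) (f : C_c(G, A)) : ‖P.v (leftMul a f)‖ ≤ ‖a‖ * ‖P.v f‖ := by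
  obtain ⟨b, hb, hab⟩ := exists_sqrt_norm_sq_sub a
  let B : C_c(G, A) → C_c(G, A) := fun h => (‖a‖ : ℂ) • h + leftMul b h
  have hB : ∀ h k, Inner.inner ℂ (P.v (B h)) (P.v k) = Inner.inner ℂ (P.v h) (P.v (B k)) := by
    intro h k
    simp only [B, map_add, map_smul, inner_add_left, inner_add_right, inner_smul_left,
      inner_smul_right, P.inner_leftMul, hb.star_eq, Complex.conj_ofReal]
  have hBB : B (B f) = ((‖a‖ ^ 2 : ℝ) : ℂ) • f - leftMul (star a) (leftMul a f) := by
    ext t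
    have h1 : (b * b + (2 * ‖a‖) • b) * f t = -(star a * a) * f t := by rw [hab]
    rw [← Complex.coe_smul] at h1
    have h2 : b * (b * f t) = -(star a * (a * f t)) - ((2 * ‖a‖ : ℝ) : ℂ) • (b * f t) := by
      rw [← mul_assoc, ← mul_assoc, ← neg_mul, ← h1, add_mul, smul_mul_assoc]; abel
    change (‖a‖ : ℂ) • ((‖a‖ : ℂ) • f t + b * f t) + b * ((‖a‖ : ℂ) • f t + b * f t) =
      ((‖a‖ ^ 2 : ℝ) : ℂ) • f t - star a * (a * f t)
    rw [mul_add, mul_smul_comm, h2]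
    push_cast
    module
  have h1 : Inner.inner ℂ (P.v (B f)) (P.v (B f)) =
      ((‖a‖ ^ 2 : ℝ) : ℂ) * Inner.inner ℂ (P.v f) (P.v f) -
        Inner.inner ℂ (P.v (leftMul a f)) (P.v (leftMul a f)) := by
    rw [hB, hBB, map_sub, map_smul, inner_sub_right, inner_smul_right, P.inner_leftMul a f]
  rw [inner_self_eq_norm_sq_to_K, inner_self_eq_norm_sq_to_K, inner_self_eq_norm_sq_to_K] at h1
  have h2 : ‖P.v (B f)‖ ^ 2 = ‖a‖ ^ 2 * ‖P.v f‖ ^ 2 - ‖P.v (leftMul a f)‖ ^ 2 := by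
    rw [RCLike.ofReal_eq_complex_ofReal] at h1
    exact_mod_cast h1
  refine abs_le_of_sq_le_sq' ?_ (by positivity) |>.2
  nlinarith [sq_nonneg ‖P.v (B f)‖]

theorem norm_translate (g : G) (f : C_c(G, A)) : ‖P.v (translate g f)‖ = ‖P.v f‖ := by
  have h := P.inner_translate g f f
  rw [inner_self_eq_norm_sq_to_K, inner_self_eq_norm_sq_to_K] at h
  have h2 : ‖P.v (translate g f)‖ ^ 2 = ‖P.v f‖ ^ 2 := by exact_mod_cast h
  exact (sq_eq_sq₀ (norm_nonneg _) (norm_nonneg _)).1 h2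

/-- The action of `a ∈ A`. -/
noncomputable def opA (a : A) : P.H →L[ℂ] P.H := (P.v.comp (leftMul a)).extendOfNorm P.v

theorem opA_v (a : A) (f : C_c(G, A)) : P.opA a (P.v f) = P.v (leftMul a f) :=
  LinearMap.extendOfNorm_eq P.dense ⟨‖a‖, P.norm_leftMul_le a⟩ f

/-- The action of `g ∈ G`. -/
noncomputable def opG (g : G) : P.H →L[ℂ] P.H := (P.v.comp (translate g)).extendOfNorm P.v

theorem opG_v (g : G) (f : C_c(G, A)) : P.opG g (P.v f) = P.v (translate g f) :=
  LinearMap.extendOfNorm_eq P.dense ⟨1, fun f => by simpa using (P.norm_translate g f).le⟩ f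

theorem norm_opG_le (g : G) (ξ : P.H) : ‖P.opG g ξ‖ ≤ ‖ξ‖ := by
  simpa [opG] using LinearMap.norm_extendOfNorm_apply_le (f := P.v.comp (translate g)) P.dense 1
    (fun f => by simpa using (P.norm_translate g f).le) ξ

theorem opG_one : P.opG 1 = 1 := P.clm_ext fun f => by simp [opG_v, translate_one]

theorem opG_mul (g h : G) : P.opG (g * h) = P.opG g * P.opG h :=
  P.clm_ext fun f => by simp [opG_v, translate_mul]

theorem eq_star_of_inner {S T : P.H →L[ℂ] P.H}
    (h : ∀ f k, Inner.inner ℂ (S (P.v f)) (P.v k) = Inner.inner ℂ (P.v f) (T (P.v k))) :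
    S = star T := by
  rw [ContinuousLinearMap.star_eq_adjoint, ContinuousLinearMap.eq_adjoint_iff]
  intro x y
  induction x, y using P.dense.induction_on₂ with
  | hp => exact isClosed_eq (by fun_prop) (by fun_prop)
  | h f k => exact h f k

theorem star_opG (g : G) : star (P.opG g) = P.opG g⁻¹ := by
  refine (P.eq_star_of_inner fun f k => ?_).symm
  rw [opG_v, opG_v, ← P.inner_translate g, ← translate_mul, mul_inv_cancel, translate_one]

/-- The representation of `A`. -/
noncomputable def repA : A →⋆ₙₐ[ℂ] (P.H →L[ℂ] P.H) where
  toFun := P.opA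
  map_smul' c a := P.clm_ext fun f => by
    change P.opA (c • a) (P.v f) = c • P.opA a (P.v f)
    rw [opA_v, opA_v, ← map_smul]
    congr 1; ext t; exact smul_mul_assoc c a (f t)
  map_zero' := P.clm_ext fun f => by
    change P.opA 0 (P.v f) = 0
    rw [opA_v, ← map_zero P.v]
    congr 1; ext t; exact zero_mul (f t)
  map_add' a b := P.clm_ext fun f => by
    change P.opA (a + b) (P.v f) = P.opA a (P.v f) + P.opA b (P.v f)
    rw [opA_v, opA_v, opA_v, ← map_add]
    congr 1; ext t; exact add_mul a b (f t)
  map_mul' a b := P.clm_ext fun f => by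
    change P.opA (a * b) (P.v f) = P.opA a (P.opA b (P.v f))
    rw [opA_v, opA_v, opA_v]
    congr 1; ext t; exact mul_assoc a b (f t)
  map_star' a := P.eq_star_of_inner fun f k => by
    rw [opA_v, opA_v, P.inner_leftMul, star_star]

/-- The representation of `G`. -/
noncomputable def repG : G →* unitary (P.H →L[ℂ] P.H) where
  toFun g := ⟨P.opG g, by
    rw [Unitary.mem_iff, star_opG, ← opG_mul, ← opG_mul]
    simp [opG_one]⟩
  map_one' := Subtype.ext P.opG_one
  map_mul' g h := Subtype.ext (P.opG_mul g h)

end PreRep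

variable {A : GAlgebra G}

/-- For `g` in a compact neighbourhood the translates have supports in a common compact set. There
`g ↦ translate g f` is continuous into `C(K, A)` by currying, and `v` acts as a bounded operator. -/
theorem LocallyBounded.continuous_translate {E : Type*} [NormedAddCommGroup E]
    [NormedSpace ℂ E] {v : C_c(G, A) →ₗ[ℂ] E} (hv : LocallyBounded v)
    [LocallyCompactSpace G] [T2Space G] (f : C_c(G, A)) :
    Continuous fun g => v (translate g f) := by
  rw [continuous_iff_continuousAt]
  intro g₀
  obtain ⟨N, hN, hg₀⟩ := exists_compact_mem_nhds g₀
  obtain ⟨K, hK, T, F, hF, hT⟩ := hv.exists_slices (hN.mul f.hasCompactSupport.isCompact)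
    ⟨fun p : G × G => A.act p.1 (f (p.1⁻¹ * p.2)), A.continuous_act_uncurry.comp
      (continuous_fst.prodMk (f.continuous.comp (by fun_prop)))⟩
  refine (T.continuous.comp F.continuous).continuousAt.congr ?_
  filter_upwards [hg₀] with g hg
  have e : F g = (translate g f).toContinuousMap.restrict K := by
    ext t; exact hF g t
  rw [Function.comp_apply, e, hT]
  intro t ht
  have : f (g⁻¹ * t) = 0 := by
    refine image_eq_zero_of_notMem_tsupport fun h => ht ?_
    exact ⟨g, hg, g⁻¹ * t, h, by simp⟩
  simp [this]

/-- The convolution is the Bochner integral in `C(K, A)` of the slices of its integrand, as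
evaluation at points shows. The bounded operator induced by `v` commutes with that integral. -/
theorem LocallyBounded.integral_eq_conv {E : Type*} [NormedAddCommGroup E]
    [NormedSpace ℂ E] [CompleteSpace E] {v : C_c(G, A) →ₗ[ℂ] E} (hv : LocallyBounded v)
    [LocallyCompactSpace G] [T2Space G] [MeasurableSpace G] [BorelSpace G] (f h : C_c(G, A)) :
    ∫ s, v (leftMul (f s) (translate s h)) ∂Measure.haar = v (conv f h) := by
  obtain ⟨K, hK, T, F, hF, hT⟩ := hv.exists_slices
    (f.hasCompactSupport.isCompact.mul h.hasCompactSupport.isCompact)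
    ⟨_, continuous_conv_integrand f h⟩
  have hzero : ∀ s t, t ∉ tsupport f * tsupport h → f s * A.act s (h (s⁻¹ * t)) = 0 := by
    intro s t ht
    by_cases hs : s ∈ tsupport f
    · have : h (s⁻¹ * t) = 0 := image_eq_zero_of_notMem_tsupport fun h' =>
        ht ⟨s, hs, s⁻¹ * t, h', by simp⟩
      simp [this]
    · simp [image_eq_zero_of_notMem_tsupport hs]
  have e : ∀ s, v (leftMul (f s) (translate s h)) = T (F s) := by
    intro s
    rw [← hT _ (fun t ht => hzero s t ht)]
    congr 1; ext t; exact (hF s t).symm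
  have hFi : Integrable F (Measure.haar : Measure G) := by
    refine F.continuous.integrable_of_hasCompactSupport (f.hasCompactSupport.mono fun s hs h0 => ?_)
    refine hs (ContinuousMap.ext fun t => ?_)
    rw [hF]; simp [h0]
  simp only [e]
  rw [T.integral_comp_comm hFi, ← hT (conv f h)]
  · congr 1; ext t
    have := (ContinuousMap.evalCLM ℂ t : C(K, A) →L[ℂ] A).integral_comp_comm hFi
    refine this.symm.trans (integral_congr_ae (Filter.Eventually.of_forall fun s => ?_))
    exact hF s t
  · intro t ht
    rw [conv_apply]
    simp [hzero _ t ht]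

namespace PreRep

variable [LocallyCompactSpace G] [T2Space G] (P : PreRep A)

theorem continuous_opG (ξ : P.H) : Continuous fun g => P.opG g ξ := by
  refine continuous_of_uniform_approx_of_continuous fun U hU => ?_
  obtain ⟨ε, hε, hU⟩ := Metric.mem_uniformity_dist.1 hU
  obtain ⟨f, hf⟩ := P.dense.exists_dist_lt ξ hε
  refine ⟨_, P.locallyBounded.continuous_translate f, fun g => hU ?_⟩
  rw [← opG_v, dist_eq_norm, ← map_sub]
  exact (P.norm_opG_le g _).trans_lt (by rwa [← dist_eq_norm])

variable [MeasurableSpace G] [BorelSpace G]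

/-- The covariant representation. -/
noncomputable def toCovariantRep : CovariantRep A where
  H := P.H
  π := P.repA
  u := P.repG
  continuous_u := P.continuous_opG
  covariant g a := by
    change P.opA (A.act g a) = P.opG g * P.opA a * star (P.opG g)
    rw [star_opG]
    refine P.clm_ext fun f => ?_
    change _ = P.opG g (P.opA a (P.opG g⁻¹ (P.v f)))
    rw [opA_v, opG_v, opA_v, opG_v, translate_leftMul, ← translate_mul, mul_inv_cancel,
      translate_one]

theorem integrated_toCovariantRep (f h : C_c(G, A)) :
    P.toCovariantRep.integrated f (P.v h) = P.v (conv f h) := by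
  rw [← P.locallyBounded.integral_eq_conv]
  refine integral_congr_ae (Filter.Eventually.of_forall fun s => ?_)
  change P.opA (f s) (P.opG s (P.v h)) = _
  rw [opG_v, opA_v]

end PreRep

end ExoticCrossedProduct

namespace ExoticCrossedProduct

universe u

/-! ### Representations of `C_c(G, A)` in C⋆-algebras are bounded by the maximal norm -/

variable {G : Type u} [Group G] [TopologicalSpace G] [IsTopologicalGroup G]
  [LocallyCompactSpace G] [MeasurableSpace G] [BorelSpace G] {A : GAlgebra G}

/-- A locally bounded `*`-homomorphism with dense range from `C_c(G, A)` to a C⋆-algebra. -/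
structure IsDenseRep {Q : Type u} [NonUnitalCStarAlgebra Q] (κ : C_c(G, A) →ₗ[ℂ] Q) : Prop where
  map_conv : ∀ f g, κ (conv f g) = κ f * κ g
  map_involution : ∀ f, κ (involution f) = star (κ f)
  dense : DenseRange κ
  locallyBounded : LocallyBounded κ

theorem maxNorm_nonneg (f : C_c(G, A)) : 0 ≤ maxNorm f :=
  Real.sSup_nonneg (by rintro r ⟨R, ξ, -, rfl⟩; exact norm_nonneg _)

theorem norm_integrated_le_maxNorm (R : CovariantRep A) (f : C_c(G, A)) {ξ : R.H} (hξ : ‖ξ‖ ≤ 1) :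
    ‖R.integrated f ξ‖ ≤ maxNorm f :=
  le_csSup (bddAbove_maxNormValues f) ⟨R, ξ, hξ, rfl⟩

namespace IsDenseRep

open scoped ComplexOrder

variable {Q : Type u} [NonUnitalCStarAlgebra Q] {κ : C_c(G, A) →ₗ[ℂ] Q}

theorem map_leftMul (hκ : IsDenseRep κ) (a : A) (f h : C_c(G, A)) :
    star (κ (leftMul a f)) * κ h = star (κ f) * κ (leftMul (star a) h) := by
  rw [← hκ.map_involution, ← hκ.map_conv, conv_involution_leftMul, hκ.map_conv, hκ.map_involution]

theorem map_translate (hκ : IsDenseRep κ) (g : G) (f h : C_c(G, A)) :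
    star (κ (translate g f)) * κ (translate g h) = star (κ f) * κ h := by
  rw [← hκ.map_involution, ← hκ.map_conv, conv_involution_translate, hκ.map_conv,
    hκ.map_involution]

variable [PartialOrder Q] [StarOrderedRing Q]

theorem norm_toPreGNS_le {φ : Q →ₚ[ℂ] ℂ} (hφ : ∀ x, ‖φ x‖ ≤ ‖x‖) (x : Q) :
    ‖φ.toPreGNS x‖ ≤ ‖x‖ := by
  refine abs_le_of_sq_le_sq' ?_ (norm_nonneg _) |>.2
  have h := φ.preGNS_norm_sq (φ.toPreGNS x)
  have h2 := congrArg (fun z : ℂ => ‖z‖) h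
  simp only [PositiveLinearMap.ofPreGNS_toPreGNS, norm_pow, Complex.norm_real, norm_norm] at h2
  rw [h2]
  refine (hφ _).trans ?_
  rw [CStarRing.norm_star_mul_self, sq]

/-- The GNS representation of a positive functional on `Q`, as a map on `C_c(G, A)`. -/
noncomputable def toPreRep (hκ : IsDenseRep κ) (φ : Q →ₚ[ℂ] ℂ) (hφ : ∀ x, ‖φ x‖ ≤ ‖x‖) :
    PreRep A where
  H := φ.GNS
  v := (UniformSpace.Completion.toComplL : φ.PreGNS →L[ℂ] φ.GNS).toLinearMap.comp
    (φ.toPreGNS.toLinearMap.comp κ)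
  dense := by
    have h1 : Continuous φ.toPreGNS :=
      AddMonoidHomClass.continuous_of_bound φ.toPreGNS 1 fun x => by
        simpa using norm_toPreGNS_le hφ x
    have h2 : DenseRange fun x : Q => (φ.toPreGNS x : φ.GNS) :=
      UniformSpace.Completion.denseRange_coe.comp φ.toPreGNS.surjective.denseRange
        (UniformSpace.Completion.continuous_coe _)
    exact h2.comp hκ.dense ((UniformSpace.Completion.continuous_coe _).comp h1)
  inner_leftMul a f h := by
    change Inner.inner ℂ (φ.toPreGNS (κ (leftMul a f)) : φ.GNS) (φ.toPreGNS (κ h)) =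
      Inner.inner ℂ (φ.toPreGNS (κ f) : φ.GNS) (φ.toPreGNS (κ (leftMul (star a) h)))
    simp only [UniformSpace.Completion.inner_coe, PositiveLinearMap.preGNS_inner_def,
      PositiveLinearMap.ofPreGNS_toPreGNS, hκ.map_leftMul]
  inner_translate g f h := by
    change Inner.inner ℂ (φ.toPreGNS (κ (translate g f)) : φ.GNS)
      (φ.toPreGNS (κ (translate g h))) =
      Inner.inner ℂ (φ.toPreGNS (κ f) : φ.GNS) (φ.toPreGNS (κ h))
    simp only [UniformSpace.Completion.inner_coe, PositiveLinearMap.preGNS_inner_def,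
      PositiveLinearMap.ofPreGNS_toPreGNS, hκ.map_translate]
  locallyBounded K _ c := by
    obtain ⟨M, hM⟩ := hκ.locallyBounded K c
    refine ⟨M, fun f => le_trans ?_ (hM f)⟩
    change ‖(φ.toPreGNS (κ (c.extend f)) : φ.GNS)‖ ≤ _
    rw [UniformSpace.Completion.norm_coe]
    exact norm_toPreGNS_le hφ _

variable [T2Space G]

/-- On the dense image of `C_c(G, A)` both the GNS operator of `κ f` and the integrated form of the
covariant representation are convolution by `f`, so the maximal norm bounds the former. -/
theorem norm_gns_le (hκ : IsDenseRep κ) {φ : Q →ₚ[ℂ] ℂ} (hφ : ∀ x, ‖φ x‖ ≤ ‖x‖)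
    (f : C_c(G, A)) (ξ : φ.GNS) :
    ‖φ.gnsNonUnitalStarAlgHom (κ f) ξ‖ ≤ maxNorm f * ‖ξ‖ := by
  let P := hκ.toPreRep φ hφ
  let w : C_c(G, A) →ₗ[ℂ] φ.GNS := P.v
  let σ : φ.GNS →L[ℂ] φ.GNS := φ.gnsNonUnitalStarAlgHom (κ f)
  have hv : ∀ h, σ (w h) = w (conv f h) := fun h => by
    change φ.gnsNonUnitalStarAlgHom (κ f) (φ.toPreGNS (κ h) : φ.GNS) =
      (φ.toPreGNS (κ (conv f h)) : φ.GNS)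
    rw [PositiveLinearMap.gnsNonUnitalStarAlgHom_apply_coe, hκ.map_conv]
    rfl
  have hunit : ∀ h, ‖w h‖ ≤ 1 → ‖σ (w h)‖ ≤ maxNorm f := by
    intro h hh
    have := norm_integrated_le_maxNorm P.toCovariantRep f (ξ := w h) hh
    rw [hv]
    exact (congrArg norm (P.integrated_toCovariantRep f h)).symm.trans_le this
  refine DenseRange.induction_on (show DenseRange w from P.dense) (p := fun ξ => ‖σ ξ‖ ≤ maxNorm f * ‖ξ‖)
    ξ (isClosed_le (by fun_prop) (by fun_prop)) fun h => ?_
  by_cases h0 : ‖w h‖ = 0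
  · rw [norm_eq_zero.1 h0, map_zero, norm_zero, mul_zero]
  have h1 := hunit (((‖w h‖⁻¹ : ℝ) : ℂ) • h) (by
    rw [map_smul, norm_smul, Complex.norm_real, norm_inv, norm_norm, inv_mul_cancel₀ h0])
  rw [map_smul, map_smul, norm_smul, Complex.norm_real, norm_inv, norm_norm,
    inv_mul_le_iff₀ (lt_of_le_of_ne (norm_nonneg _) (Ne.symm h0)), mul_comm] at h1
  exact h1

end IsDenseRep

/-- Locally bounded `*`-homomorphisms on `C_c(G, A)` are bounded by the maximal norm. -/
theorem IsDenseRep.norm_le_maxNorm [T2Space G] {Q : Type u} [NonUnitalCStarAlgebra Q]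
    {κ : C_c(G, A) →ₗ[ℂ] Q} (hκ : IsDenseRep κ) (f : C_c(G, A)) : ‖κ f‖ ≤ maxNorm f := by
  let _ : PartialOrder Q := CStarAlgebra.spectralOrder Q
  let _ : StarOrderedRing Q := CStarAlgebra.spectralOrderedRing Q
  set q := κ f with hq
  set y := star q * q with hy
  have hys : star y = y := (IsSelfAdjoint.star_mul_self q).star_eq
  have hyn : ‖y‖ = ‖q‖ ^ 2 := by rw [hy, CStarRing.norm_star_mul_self, sq]
  have hz : star (q * y) * (q * y) = y * y * y := by
    rw [star_mul, hys, mul_assoc, ← mul_assoc (star q), ← hy, ← mul_assoc]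
  -- `Q` may lack a unit, so the GNS vector of `y` serves as test vector. With `φ` norming `(q y)^*
  -- (q y) = y³`, it follows that `‖y‖³ ≤ ‖[q y]‖² ≤ maxNorm(f)² ‖y‖²`, where `‖y‖ = ‖q‖²`.
  obtain ⟨φ, hφ, hφz⟩ := exists_positive_functional (star_mul_self_nonneg (q * y))
  have hz3 : ‖y‖ ^ 3 ≤ ‖star (q * y) * (q * y)‖ := by
    rcases eq_or_ne ‖y‖ 0 with h0 | h0
    · rw [h0]; simp
    have h2 : ‖y * y‖ = ‖y‖ ^ 2 := by
      nth_rewrite 1 [← hys]; rw [CStarRing.norm_star_mul_self, sq]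
    have h4 : ‖y * y * (y * y)‖ = ‖y‖ ^ 4 := by
      nth_rewrite 1 [show y * y = star (y * y) by rw [star_mul, hys]]
      rw [CStarRing.norm_star_mul_self, h2]; ring
    have h5 : ‖y‖ ^ 3 * ‖y‖ ≤ ‖y * y * y‖ * ‖y‖ := by
      calc _ = ‖y * y * (y * y)‖ := by rw [h4]; ring
        _ = ‖y * y * y * y‖ := by rw [← mul_assoc]
        _ ≤ _ := norm_mul_le _ _
    rw [hz]
    exact le_of_mul_le_mul_right h5 (lt_of_le_of_ne (norm_nonneg _) (Ne.symm h0))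
  have h1 := hκ.norm_gns_le hφ f (φ.toPreGNS y)
  rw [PositiveLinearMap.gnsNonUnitalStarAlgHom_apply_coe, UniformSpace.Completion.norm_coe,
    UniformSpace.Completion.norm_coe] at h1
  have e1 : φ.leftMulMapPreGNS (κ f) (φ.toPreGNS y) = φ.toPreGNS (q * y) := rfl
  rw [e1] at h1
  have e2 : ‖φ.toPreGNS (q * y)‖ ^ 2 = ‖star (q * y) * (q * y)‖ := by
    have h := φ.preGNS_norm_sq (φ.toPreGNS (q * y))
    rw [PositiveLinearMap.ofPreGNS_toPreGNS, hφz] at h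
    exact_mod_cast h
  have h2 : ‖y‖ ^ 3 ≤ (maxNorm f) ^ 2 * ‖y‖ ^ 2 := by
    calc ‖y‖ ^ 3 ≤ ‖φ.toPreGNS (q * y)‖ ^ 2 := by rw [e2]; exact hz3
      _ ≤ (maxNorm f * ‖φ.toPreGNS y‖) ^ 2 := by gcongr
      _ ≤ (maxNorm f * ‖y‖) ^ 2 := by
        have := IsDenseRep.norm_toPreGNS_le hφ y
        have := maxNorm_nonneg f
        gcongr
      _ = _ := by ring
  rcases eq_or_ne ‖y‖ 0 with h0 | h0
  · have : ‖q‖ = 0 := by rw [h0] at hyn; exact pow_eq_zero_iff two_ne_zero |>.1 hyn.symm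
    rw [this]; exact maxNorm_nonneg f
  · have hpos : 0 < ‖y‖ ^ 2 := pow_pos (lt_of_le_of_ne (norm_nonneg _) (Ne.symm h0)) 2
    have h3 : ‖y‖ ≤ maxNorm f ^ 2 := by
      refine le_of_mul_le_mul_right ?_ hpos
      calc ‖y‖ * ‖y‖ ^ 2 = ‖y‖ ^ 3 := by ring
        _ ≤ _ := h2
    rw [hyn] at h3
    exact abs_le_of_sq_le_sq' h3 (maxNorm_nonneg f) |>.2

end ExoticCrossedProduct

open scoped ENNReal Pointwise

namespace ExoticCrossedProduct

universe u

/-! ### Constructions of `G`-algebras -/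

noncomputable section Constructions

variable {G : Type u} [Group G] [TopologicalSpace G]

/-- An action of `G` on a C⋆-algebra by `*`-endomorphisms, not necessarily continuous. -/
structure CStarAction (G : Type u) [Group G] (Y : Type u) [NonUnitalCStarAlgebra Y] where
  hom : G → (Y →⋆ₙₐ[ℂ] Y)
  one : ∀ y, hom 1 y = y
  mul : ∀ g h y, hom (g * h) y = hom g (hom h y)

namespace CStarAction

variable {Y : Type u} [NonUnitalCStarAlgebra Y] (β : CStarAction G Y)

/-- The elements with continuous orbits. -/
def continuousPart : NonUnitalStarSubalgebra ℂ Y where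
  carrier := {y | Continuous fun g => β.hom g y}
  add_mem' {x y} hx hy :=
    (Continuous.add hx hy).congr fun g => (map_add (β.hom g) x y).symm
  zero_mem' := continuous_const.congr fun g => (map_zero (β.hom g)).symm
  mul_mem' {x y} hx hy :=
    (Continuous.mul hx hy).congr fun g => (map_mul (β.hom g) x y).symm
  smul_mem' c y hy := (Continuous.const_smul hy c).congr fun g => (map_smul (β.hom g) c y).symm
  star_mem' {y} hy := (Continuous.star hy).congr fun g => (map_star (β.hom g) y).symm

/-- The `β_g` are contractive, so the orbit map of a limit is a uniform limit of continuous orbit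
maps. -/
theorem isClosed_continuousPart : IsClosed (β.continuousPart : Set Y) := by
  refine isClosed_of_closure_subset fun y hy => ?_
  refine continuous_of_uniform_approx_of_continuous fun U hU => ?_
  obtain ⟨ε, hε, hU⟩ := Metric.mem_uniformity_dist.1 hU
  obtain ⟨x, hx, hyx⟩ := Metric.mem_closure_iff.1 hy ε hε
  refine ⟨_, hx, fun g => hU ?_⟩
  rw [dist_eq_norm, ← map_sub]
  exact (NonUnitalStarAlgHom.norm_apply_le (β.hom g) _).trans_lt (by rwa [← dist_eq_norm])

/-- The `G`-algebra defined by a closed invariant subalgebra of elements with continuous orbits. -/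
def toGAlgebra (S : NonUnitalStarSubalgebra ℂ Y) (hS : IsClosed (S : Set Y))
    (hinv : ∀ g, ∀ y ∈ S, β.hom g y ∈ S) (hcont : S ≤ β.continuousPart) : GAlgebra G where
  carrier := S
  cstar := NonUnitalStarSubalgebra.nonUnitalCStarAlgebra S (h_closed := hS)
  act :=
    { toFun := fun g =>
        { toFun := fun y => ⟨β.hom g y, hinv g y y.2⟩
          invFun := fun y => ⟨β.hom g⁻¹ y, hinv g⁻¹ y y.2⟩
          left_inv := fun y => Subtype.ext (by
            change β.hom g⁻¹ (β.hom g y) = y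
            rw [← β.mul, inv_mul_cancel, β.one])
          right_inv := fun y => Subtype.ext (by
            change β.hom g (β.hom g⁻¹ y) = y
            rw [← β.mul, mul_inv_cancel, β.one])
          map_mul' := fun x y => Subtype.ext (map_mul (β.hom g) (x : Y) y)
          map_add' := fun x y => Subtype.ext (map_add (β.hom g) (x : Y) y)
          map_star' := fun x => Subtype.ext (map_star (β.hom g) (x : Y))
          map_smul' := fun c x => Subtype.ext (map_smul (β.hom g) c (x : Y)) }
      map_one' := by ext y; exact β.one y
      map_mul' := fun g h => by ext y; exact β.mul g h y }
  continuous_act y := (hcont y.2).subtype_mk _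

end CStarAction

/-- The action of a `G`-algebra. -/
def GAlgebra.action (A : GAlgebra G) : CStarAction G A where
  hom g := (A.act g : A →⋆ₙₐ[ℂ] A)
  one y := by simp
  mul g h y := by simp

/-- The product of two actions. -/
def CStarAction.prod {Y Z : Type u} [NonUnitalCStarAlgebra Y] [NonUnitalCStarAlgebra Z]
    (β : CStarAction G Y) (γ : CStarAction G Z) : CStarAction G (Y × Z) where
  hom g := NonUnitalStarAlgHom.prod ((β.hom g).comp (NonUnitalStarAlgHom.fst ℂ Y Z))
    ((γ.hom g).comp (NonUnitalStarAlgHom.snd ℂ Y Z))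
  one y := by ext <;> simp [β.one, γ.one]
  mul g h y := by ext <;> simp [β.mul, γ.mul]

/-- Kernels of equivariant maps are `G`-algebras. -/
def kernel {A B : GAlgebra G} (φ : GHom A B) : GAlgebra G :=
  A.action.toGAlgebra
    { carrier := {a | φ.toHom a = 0}
      add_mem' := fun {x y} (hx : φ.toHom x = 0) (hy : φ.toHom y = 0) => by simp [hx, hy]
      zero_mem' := map_zero φ.toHom
      mul_mem' := fun {x y} (hx : φ.toHom x = 0) (hy : φ.toHom y = 0) => by simp [hx]
      smul_mem' := fun c x (hx : φ.toHom x = 0) => by simp [hx]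
      star_mem' := fun {x} (hx : φ.toHom x = 0) => by simp [hx, map_star] }
    (isClosed_eq φ.continuous continuous_const)
    (fun g y (hy : φ.toHom y = 0) => by
      change φ.toHom (A.act g y) = 0
      rw [φ.map_act, hy, map_zero])
    (fun y _ => A.continuous_act y)

/-- The inclusion of the kernel. -/
def kernelInclusion {A B : GAlgebra G} (φ : GHom A B) : GHom (kernel φ) A where
  toHom :=
    { toFun := fun a => a.1
      map_smul' := fun _ _ => rfl
      map_zero' := rfl
      map_add' := fun _ _ => rfl
      map_mul' := fun _ _ => rfl
      map_star' := fun _ => rfl }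
  map_act _ _ := rfl

theorem kernelInclusion_injective {A B : GAlgebra G} (φ : GHom A B) :
    Function.Injective (kernelInclusion φ) := Subtype.val_injective

theorem exact_kernelInclusion {A B : GAlgebra G} (φ : GHom A B) :
    Function.Exact (kernelInclusion φ) φ :=
  fun a => ⟨fun h => ⟨⟨a, h⟩, rfl⟩, by rintro ⟨x, rfl⟩; exact x.2⟩

theorem range_kernelInclusion {A B : GAlgebra G} (φ : GHom A B) :
    LinearMap.range ((kernelInclusion φ).toHom : kernel φ →ₗ[ℂ] A) =
      LinearMap.ker (φ.toHom : A →ₗ[ℂ] B) :=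
  Submodule.ext fun a => ((exact_kernelInclusion φ) a).symm

/-! ### Pullbacks of two equivariant maps -/

section Pullback

variable {A B D : GAlgebra G} (φ : GHom A B) (π : GHom D B)

/-- The pullback `A ×_B D`. -/
def pullback : GAlgebra G :=
  (A.action.prod D.action).toGAlgebra
    { carrier := {p | φ.toHom p.1 = π.toHom p.2}
      add_mem' := fun {x y} (hx : φ.toHom x.1 = π.toHom x.2) (hy : φ.toHom y.1 = π.toHom y.2) => by
        simp [hx, hy]
      zero_mem' := by simp
      mul_mem' := fun {x y} (hx : φ.toHom x.1 = π.toHom x.2) (hy : φ.toHom y.1 = π.toHom y.2) => by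
        simp [hx, hy]
      smul_mem' := fun c x (hx : φ.toHom x.1 = π.toHom x.2) => by simp [hx]
      star_mem' := fun {x} (hx : φ.toHom x.1 = π.toHom x.2) => by simp [hx, map_star] }
    (isClosed_eq (φ.continuous.comp continuous_fst) (π.continuous.comp continuous_snd))
    (fun g y (hy : φ.toHom y.1 = π.toHom y.2) => by
      change φ.toHom (A.act g y.1) = π.toHom (D.act g y.2)
      rw [φ.map_act, hy, π.map_act])
    (fun y _ => (A.continuous_act y.1).prodMk (D.continuous_act y.2))

/-- The first projection of the pullback. -/
def pullbackFst : GHom (pullback φ π) A where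
  toHom :=
    { toFun := fun p => p.1.1
      map_smul' := fun _ _ => rfl
      map_zero' := rfl
      map_add' := fun _ _ => rfl
      map_mul' := fun _ _ => rfl
      map_star' := fun _ => rfl }
  map_act _ _ := rfl

/-- The second projection of the pullback. -/
def pullbackSnd : GHom (pullback φ π) D where
  toHom :=
    { toFun := fun p => p.1.2
      map_smul' := fun _ _ => rfl
      map_zero' := rfl
      map_add' := fun _ _ => rfl
      map_mul' := fun _ _ => rfl
      map_star' := fun _ => rfl }
  map_act _ _ := rfl

theorem pullback_condition (p : pullback φ π) :
    φ (pullbackFst φ π p) = π (pullbackSnd φ π p) := p.2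

theorem pullbackFst_surjective (hπ : Function.Surjective π) :
    Function.Surjective (pullbackFst φ π) := fun a => by
  obtain ⟨d, hd⟩ := hπ (φ a)
  exact ⟨⟨(a, d), hd.symm⟩, rfl⟩

end Pullback

/-- The `*`-homomorphism of bounded families induced by a family of `*`-homomorphisms. -/
def lpMap {ι : Type u} {C D : ι → Type u} [∀ i, NonUnitalCStarAlgebra (C i)]
    [∀ i, NonUnitalCStarAlgebra (D i)] (φ : ∀ i, C i →⋆ₙₐ[ℂ] D i) : lp C ∞ →⋆ₙₐ[ℂ] lp D ∞ where
  toFun c := ⟨fun i => φ i (c i), by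
    refine memℓp_infty ⟨‖c‖, ?_⟩
    rintro _ ⟨i, rfl⟩
    exact (NonUnitalStarAlgHom.norm_apply_le (φ i) _).trans
      (lp.norm_apply_le_norm ENNReal.top_ne_zero c i)⟩
  map_smul' a c := by ext i; exact map_smul (φ i) a (c i)
  map_zero' := by ext i; exact map_zero (φ i)
  map_add' c d := by ext i; exact map_add (φ i) (c i) (d i)
  map_mul' c d := by ext i; exact map_mul (φ i) (c i) (d i)
  map_star' c := by ext i; exact map_star (φ i) (c i)

/-! ### Fibre products of arbitrary families over a common base -/

section FibreProduct

variable {ι : Type u} (C : ι → GAlgebra G)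

/-- The coordinatewise action on bounded families. -/
def lpAction : CStarAction G (lp (fun i => C i) ∞) where
  hom g := lpMap fun i => (C i).action.hom g
  one y := by ext i; exact (C i).action.one (y i)
  mul g h y := by ext i; exact (C i).action.mul g h (y i)

variable {C} {A : GAlgebra G} (π : ∀ i, GHom (C i) A)

/-- The bounded families `c` together with an element `a` that is the common image of all `c i`. -/
def compatible : NonUnitalStarSubalgebra ℂ (lp (fun i => C i) ∞ × A) where
  carrier := {p | ∀ i, (π i).toHom (p.1 i) = p.2}
  add_mem' {p q} hp hq i := by
    change (π i).toHom (p.1 i + q.1 i) = p.2 + q.2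
    rw [map_add, hp i, hq i]
  zero_mem' i := map_zero (π i).toHom
  mul_mem' {p q} hp hq i := by
    change (π i).toHom (p.1 i * q.1 i) = p.2 * q.2
    rw [map_mul, hp i, hq i]
  smul_mem' c p hp i := by
    change (π i).toHom (c • p.1 i) = c • p.2
    rw [map_smul, hp i]
  star_mem' {p} hp i := by
    change (π i).toHom (star (p.1 i)) = star p.2
    rw [map_star, hp i]

/-- The evaluation of bounded families. -/
def lpEval (i : ι) : lp (fun i => C i) ∞ →⋆ₙₐ[ℂ] C i where
  toFun c := c i
  map_smul' _ _ := rfl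
  map_zero' := rfl
  map_add' _ _ := rfl
  map_mul' _ _ := rfl
  map_star' _ := rfl

theorem isClosed_compatible :
    IsClosed (compatible π : Set (lp (fun i => C i) ∞ × A)) := by
  have : (compatible π : Set (lp (fun i => C i) ∞ × A)) =
      ⋂ i, {p | (π i).toHom (lpEval i p.1) = p.2} := by
    ext p; simp only [Set.mem_iInter]; rfl
  rw [this]
  exact isClosed_iInter fun i => isClosed_eq ((π i).continuous.comp
    ((continuous_starHom (lpEval i)).comp continuous_fst)) continuous_snd

variable [IsTopologicalGroup G]

/-- The fibre product of a family of `G`-algebras over `A`. -/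
def fibreProduct : GAlgebra G :=
  ((lpAction C).prod A.action).toGAlgebra
    -- The coordinatewise action on bounded families need not be strongly continuous, so only
    -- elements with continuous orbits are kept.
    (compatible π ⊓ ((lpAction C).prod A.action).continuousPart)
    ((isClosed_compatible π).inter ((lpAction C).prod A.action).isClosed_continuousPart)
    (fun g p hp => by
      refine ⟨fun i => ?_, ?_⟩
      · change (π i).toHom ((C i).act g (p.1 i)) = A.act g p.2
        rw [(π i).map_act, hp.1 i]
      · have h : Continuous fun h => ((lpAction C).prod A.action).hom h p := hp.2
        exact (h.comp (continuous_mul_const g)).congr fun h =>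
          ((lpAction C).prod A.action).mul h g p)
    inf_le_right

/-- The projection of the fibre product to `A`. -/
def fibreProductBase : GHom (fibreProduct π) A where
  toHom :=
    { toFun := fun p => p.1.2
      map_smul' := fun _ _ => rfl
      map_zero' := rfl
      map_add' := fun _ _ => rfl
      map_mul' := fun _ _ => rfl
      map_star' := fun _ => rfl }
  map_act _ _ := rfl

/-- The coordinates of the fibre product. -/
def fibreProductProj (i : ι) : GHom (fibreProduct π) (C i) where
  toHom :=
    { toFun := fun p => p.1.1 i
      map_smul' := fun _ _ => rfl
      map_zero' := rfl
      map_add' := fun _ _ => rfl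
      map_mul' := fun _ _ => rfl
      map_star' := fun _ => rfl }
  map_act _ _ := rfl

theorem fibreProduct_condition (i : ι) (p : fibreProduct π) :
    π i (fibreProductProj π i p) = fibreProductBase π p := p.2.1 i

end FibreProduct

end Constructions

end ExoticCrossedProduct

open scoped ENNReal Pointwise

namespace ExoticCrossedProduct

universe u

/-! ### Averaging over the group and surjectivity of fibre products -/

section Smear

variable {G : Type u} [Group G] [TopologicalSpace G] [IsTopologicalGroup G]

/-- The left translate `s ↦ χ(h⁻¹ s)`. -/
def leftTranslate (h : G) (χ : C_c(G, ℝ)) : C_c(G, ℝ) where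
  toFun s := χ (h⁻¹ * s)
  continuous_toFun := χ.continuous.comp (continuous_const.mul continuous_id)
  hasCompactSupport' := χ.hasCompactSupport.comp_homeomorph (Homeomorph.mulLeft h⁻¹)

variable [LocallyCompactSpace G] [MeasurableSpace G] [BorelSpace G]

theorem integrable_smear_integrand (A : GAlgebra G) (χ : C_c(G, ℝ)) (a : A) :
    Integrable (fun s => χ s • A.act s a) (Measure.haar : Measure G) :=
  (χ.continuous.smul (A.continuous_act a)).integrable_of_hasCompactSupport
    (f := fun s => χ s • A.act s a)
    (χ.hasCompactSupport.mono fun s hs h0 => hs (by simp [h0]))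

/-- The average `∫ χ(s) α_s(a) ds`. -/
noncomputable def smear {A : GAlgebra G} (χ : C_c(G, ℝ)) (a : A) : A :=
  ∫ s, χ s • A.act s a ∂Measure.haar

theorem norm_smear_le {A : GAlgebra G} (χ : C_c(G, ℝ)) (a : A) :
    ‖smear χ a‖ ≤ (∫ s, ‖χ s‖ ∂Measure.haar) * ‖a‖ := by
  rw [← integral_mul_const]
  refine norm_integral_le_of_norm_le ?_ (Filter.Eventually.of_forall fun s => ?_)
  · exact (χ.continuous.norm.integrable_of_hasCompactSupport χ.hasCompactSupport.norm).mul_const _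
  · rw [norm_smul, A.norm_act]

theorem smear_sub {A : GAlgebra G} (χ χ' : C_c(G, ℝ)) (a : A) :
    smear (χ - χ') a = smear χ a - smear χ' a := by
  simp only [smear]
  rw [← integral_sub (integrable_smear_integrand A χ a) (integrable_smear_integrand A χ' a)]
  simp [sub_smul]

theorem map_smear {A B : GAlgebra G} (φ : GHom A B) (χ : C_c(G, ℝ)) (a : A) :
    φ (smear χ a) = smear χ (φ a) := by
  let L : A →L[ℂ] B := ⟨(φ.toHom : A →ₗ[ℂ] B), φ.continuous⟩
  refine (L.integral_comp_comm (integrable_smear_integrand A χ a)).symm.trans ?_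
  refine integral_congr_ae (Filter.Eventually.of_forall fun s => ?_)
  change L (χ s • A.act s a) = χ s • B.act s (φ.toHom a)
  rw [← φ.map_act, ← Complex.coe_smul, map_smul, Complex.coe_smul]
  rfl

theorem act_smear {A : GAlgebra G} (h : G) (χ : C_c(G, ℝ)) (a : A) :
    A.act h (smear χ a) = smear (leftTranslate h χ) a := by
  let L : A →L[ℂ] A := ⟨((A.act h : A →⋆ₙₐ[ℂ] A) : A →ₗ[ℂ] A),
    continuous_starHom (A.act h : A →⋆ₙₐ[ℂ] A)⟩
  have e : ∀ s, χ s • A.act (h * s) a = L (χ s • A.act s a) := fun s => by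
    rw [← Complex.coe_smul, ← Complex.coe_smul, map_smul, map_mul]; rfl
  refine (L.integral_comp_comm (integrable_smear_integrand A χ a)).symm.trans ?_
  simp only [← e]
  rw [smear, ← integral_mul_left_eq_self (fun s => leftTranslate h χ s • A.act s a) h]
  refine integral_congr_ae (Filter.Eventually.of_forall fun s => ?_)
  change _ = χ (h⁻¹ * (h * s)) • _
  rw [inv_mul_cancel_left]

/-- Near `h₀` all integrands have supports in a common compact set, so the integral depends
continuously on `h`. This gives orbit continuity for averages, uniformly over norm-bounded families.
-/
theorem tendsto_integral_norm_leftTranslate_sub (χ : C_c(G, ℝ)) (h₀ : G) :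
    Filter.Tendsto (fun h => ∫ s, ‖(leftTranslate h χ - leftTranslate h₀ χ) s‖ ∂Measure.haar)
      (𝓝 h₀) (𝓝 0) := by
  obtain ⟨N, hN, hh₀⟩ := exists_compact_mem_nhds h₀
  have hc : ContinuousOn
      (fun h => ∫ s, ‖(leftTranslate h χ - leftTranslate h₀ χ) s‖ ∂Measure.haar) N := by
    refine continuousOn_integral_of_compact_support
      (hN.mul χ.hasCompactSupport.isCompact) ?_ ?_
    · refine Continuous.continuousOn ?_
      change Continuous fun p : G × G => ‖χ (p.1⁻¹ * p.2) - χ (h₀⁻¹ * p.2)‖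
      have := χ.continuous
      fun_prop
    · intro h s hh hs
      have key : ∀ k ∈ N, χ (k⁻¹ * s) = 0 := fun k hk =>
        image_eq_zero_of_notMem_tsupport fun h' => hs ⟨k, hk, k⁻¹ * s, h', by simp⟩
      change ‖χ (h⁻¹ * s) - χ (h₀⁻¹ * s)‖ = 0
      rw [key h hh, key h₀ (mem_of_mem_nhds hh₀), sub_zero, norm_zero]
  have := (hc.continuousAt hh₀).tendsto
  simpa using this

/-- Averages approximate. -/
theorem exists_smear_approx [T2Space G] {A : GAlgebra G} (a : A) {ε : ℝ} (hε : 0 < ε) :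
    ∃ χ : C_c(G, ℝ), ‖smear χ a - a‖ ≤ ε := by
  have h1 : ∀ᶠ g in 𝓝 (1 : G), ‖A.act g a - a‖ < ε := by
    have : Continuous fun g => ‖A.act g a - a‖ := ((A.continuous_act a).sub continuous_const).norm
    have h2 := this.tendsto 1
    rw [show ‖A.act 1 a - a‖ = 0 by simp] at h2
    exact h2.eventually_lt_const hε
  obtain ⟨U, hU, hUo, h1U⟩ := eventually_nhds_iff.1 h1
  obtain ⟨χ, hχ1, hχc, hχU, hχ⟩ := exists_continuousMap_one_of_isCompact_subset_isOpen
    (isCompact_singleton (x := (1 : G))) hUo (by simpa using h1U)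
  let χ₀ : C_c(G, ℝ) := ⟨χ, hχc⟩
  have hpos : 0 < ∫ s, χ s ∂(Measure.haar : Measure G) :=
    χ.continuous.integral_pos_of_hasCompactSupport_nonneg_nonzero hχc (fun s => (hχ s).1)
      (x := 1) (by rw [hχ1 rfl]; simp)
  set k := ∫ s, χ s ∂(Measure.haar : Measure G) with hk
  have hint₀ : Integrable (fun s => χ s • A.act s a) (Measure.haar : Measure G) :=
    integrable_smear_integrand A χ₀ a
  have hint : Integrable χ (Measure.haar : Measure G) :=
    χ.continuous.integrable_of_hasCompactSupport hχc
  refine ⟨k⁻¹ • χ₀, ?_⟩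
  have e0 : smear (k⁻¹ • χ₀) a = k⁻¹ • ∫ s, χ s • A.act s a ∂Measure.haar := by
    rw [smear, ← integral_smul]
    simp only [smul_smul]; rfl
  have e1 : smear (k⁻¹ • χ₀) a - a = k⁻¹ • ∫ s, χ s • (A.act s a - a) ∂Measure.haar := by
    simp only [smul_sub]
    rw [integral_sub hint₀ (hint.smul_const a), integral_smul_const,
      ← hk, smul_sub, smul_smul, inv_mul_cancel₀ hpos.ne', one_smul, e0]
  rw [e1, norm_smul, norm_inv, Real.norm_of_nonneg hpos.le, inv_mul_le_iff₀ hpos, hk,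
    ← integral_mul_const]
  refine norm_integral_le_of_norm_le (hint.mul_const ε) (Filter.Eventually.of_forall fun s => ?_)
  rw [norm_smul, Real.norm_of_nonneg (hχ s).1]
  by_cases hs : s ∈ U
  · exact mul_le_mul_of_nonneg_left (hU s hs).le (hχ s).1
  · have : χ s = 0 := image_eq_zero_of_notMem_tsupport fun h => hs (hχU h)
    simp [this]

/-- The base projection of a fibre product of surjections is surjective. -/
theorem fibreProductBase_surjective [T2Space G] {ι : Type u} {C : ι → GAlgebra G} {A : GAlgebra G}
    (π : ∀ i, GHom (C i) A) (hπ : ∀ i, Function.Surjective (π i)) :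
    Function.Surjective (fibreProductBase π) := by
  refine surjective_of_denseRange (fibreProductBase π).toHom fun a =>
    Metric.mem_closure_iff.2 fun ε hε => ?_
  obtain ⟨χ, hχ⟩ := exists_smear_approx a (half_pos hε)
  -- The bound must not depend on `i`, so that the lifts form an element of the bounded product.
  have hlift : ∀ i, ∃ c : C i, π i c = a ∧ ‖c‖ ≤ ‖a‖ + 1 := fun i => by
    obtain ⟨c₀, hc₀⟩ := hπ i a
    obtain ⟨c, hc, hcn⟩ := exists_preimage_norm_lt (π i).toHom c₀ zero_lt_one
    have hc₀' : (π i).toHom c₀ = a := hc₀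
    rw [hc₀'] at hc hcn
    exact ⟨c, hc, hcn.le⟩
  choose c hca hcn using hlift
  have hbound : ∀ (χ : C_c(G, ℝ)) i, ‖smear χ (c i)‖ ≤
      (∫ s, ‖χ s‖ ∂Measure.haar) * (‖a‖ + 1) := fun χ i =>
    (norm_smear_le χ (c i)).trans (by
      have : 0 ≤ ∫ s, ‖χ s‖ ∂(Measure.haar : Measure G) := integral_nonneg fun s => norm_nonneg _
      gcongr; exact hcn i)
  -- The same weight is used in every coordinate. Translating `S χ` only translates `χ`, and `S` is
  -- Lipschitz for the `L¹`-norm of the weight, so the orbit is continuous uniformly in `i`.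
  let S : C_c(G, ℝ) → lp (fun i => C i) ∞ := fun χ => ⟨fun i => smear χ (c i), by
    refine memℓp_infty ⟨(∫ s, ‖χ s‖ ∂Measure.haar) * (‖a‖ + 1), ?_⟩
    rintro _ ⟨i, rfl⟩
    exact hbound χ i⟩
  have hSn : ∀ χ χ', ‖S χ - S χ'‖ ≤ (∫ s, ‖(χ - χ') s‖ ∂Measure.haar) * (‖a‖ + 1) := by
    intro χ χ'
    refine lp.norm_le_of_forall_le (mul_nonneg (integral_nonneg fun s => norm_nonneg _)
      (by positivity)) fun i => ?_
    have : (S χ - S χ') i = smear (χ - χ') (c i) := (smear_sub χ χ' (c i)).symm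
    rw [this]
    exact hbound _ i
  let p : lp (fun i => C i) ∞ × A := (S χ, smear χ a)
  have hp1 : p ∈ compatible π := fun i => by
    change (π i) (smear χ (c i)) = smear χ a
    rw [map_smear, hca]
  have hp2 : p ∈ ((lpAction C).prod A.action).continuousPart := by
    change Continuous fun g => ((lpAction C).hom g (S χ), A.act g (smear χ a))
    refine Continuous.prodMk ?_ (A.continuous_act _)
    have e : ∀ g, (lpAction C).hom g (S χ) = S (leftTranslate g χ) := fun g => by
      ext i; exact act_smear g χ (c i)
    simp only [e]
    rw [continuous_iff_continuousAt]
    intro g₀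
    rw [ContinuousAt, tendsto_iff_norm_sub_tendsto_zero]
    refine squeeze_zero (fun _ => norm_nonneg _) (fun g => hSn _ _) ?_
    simpa using (tendsto_integral_norm_leftTranslate_sub χ g₀).mul_const (‖a‖ + 1)
  refine ⟨smear χ a, ⟨⟨p, hp1, hp2⟩, rfl⟩, ?_⟩
  rw [dist_comm, dist_eq_norm]
  linarith

end Smear

end ExoticCrossedProduct

namespace ExoticCrossedProduct

universe u

/-! ### The quotients `(C ⋊_μ G) / (I ⋊_{μ,C} G)` -/

variable {G : Type u} [Group G] [TopologicalSpace G] [IsTopologicalGroup G]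
  [LocallyCompactSpace G] [MeasurableSpace G] [BorelSpace G]

theorem norm_unitary_apply_le {H : Type*} [NormedAddCommGroup H] [InnerProductSpace ℂ H]
    [CompleteSpace H] (U : unitary (H →L[ℂ] H)) (ξ : H) : ‖(U : H →L[ℂ] H) ξ‖ ≤ ‖ξ‖ := by
  have h : ‖(U : H →L[ℂ] H)‖ ≤ 1 := by
    rcases subsingleton_or_nontrivial (H →L[ℂ] H) with _ | _
    · simp [Subsingleton.elim (U : H →L[ℂ] H) 0]
    · exact (CStarRing.norm_coe_unitary U).le
  simpa using (U : H →L[ℂ] H).le_of_opNorm_le h ξ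

/-- The maximal norm is dominated by the `L¹`-norm. -/
theorem maxNorm_le_integral {A : GAlgebra G} (f : C_c(G, A)) :
    maxNorm f ≤ ∫ s, ‖f s‖ ∂Measure.haar := by
  refine Real.sSup_le ?_ (integral_nonneg fun s => norm_nonneg _)
  rintro r ⟨R, ξ, hξ, rfl⟩
  refine norm_integral_le_of_norm_le
    (f.continuous.norm.integrable_of_hasCompactSupport f.hasCompactSupport.norm)
    (Filter.Eventually.of_forall fun s => ?_)
  calc ‖R.π (f s) ((R.u s : R.H →L[ℂ] R.H) ξ)‖
      ≤ ‖R.π (f s)‖ * ‖(R.u s : R.H →L[ℂ] R.H) ξ‖ := ContinuousLinearMap.le_opNorm _ _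
    _ ≤ ‖f s‖ * 1 := mul_le_mul (NonUnitalStarAlgHom.norm_apply_le R.π (f s))
        ((norm_unitary_apply_le _ ξ).trans hξ) (norm_nonneg _) (norm_nonneg _)
    _ = ‖f s‖ := mul_one _

namespace CrossedProductFunctor

variable (μ : CrossedProductFunctor G) {A B C D : GAlgebra G}

theorem ι_mem_relKer (π : GHom C A) {c : C_c(G, C)} (hc : pushforward π c = 0) :
    μ.ι C c ∈ μ.relKer π :=
  Submodule.le_topologicalClosure _ (Submodule.mem_map_of_mem ((mem_ccIn_ker_iff π c).2 hc))

/-- To check that a continuous map sends `relKer` to a closed set, functions suffice. -/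
theorem relKer_induction (π : GHom C A) {s : Set (μ.obj C)} (hs : IsClosed s)
    (h : ∀ c, pushforward π c = 0 → μ.ι C c ∈ s) {x : μ.obj C} (hx : x ∈ μ.relKer π) : x ∈ s := by
  refine closure_minimal ?_ hs hx
  rintro _ ⟨c, hc, rfl⟩
  exact h c ((mem_ccIn_ker_iff π c).1 hc)

theorem isCStarIdeal_relKer (π : GHom C A) : IsCStarIdeal (μ.relKer π) where
  closed := Submodule.isClosed_topologicalClosure _
  mul_left x j hj := by
    refine μ.relKer_induction π (s := {j | x * j ∈ μ.relKer π})
      ((Submodule.isClosed_topologicalClosure _).preimage (by fun_prop)) (fun c hc => ?_) hj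
    refine (μ.ι_dense C).induction_on (p := fun x => x * μ.ι C c ∈ μ.relKer π) x
      ((Submodule.isClosed_topologicalClosure _).preimage (by fun_prop)) fun f => ?_
    rw [← μ.ι_conv]
    exact μ.ι_mem_relKer π (by rw [pushforward_conv, hc, conv_zero_right])
  mul_right {j} x hj := by
    refine μ.relKer_induction π (s := {j | j * x ∈ μ.relKer π})
      ((Submodule.isClosed_topologicalClosure _).preimage (by fun_prop)) (fun c hc => ?_) hj
    refine (μ.ι_dense C).induction_on (p := fun x => μ.ι C c * x ∈ μ.relKer π) x
      ((Submodule.isClosed_topologicalClosure _).preimage (by fun_prop)) fun f => ?_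
    rw [← μ.ι_conv]
    exact μ.ι_mem_relKer π (by rw [pushforward_conv, hc, conv_zero_left])
  star_mem {j} hj := by
    refine μ.relKer_induction π (s := {j | star j ∈ μ.relKer π})
      ((Submodule.isClosed_topologicalClosure _).preimage continuous_star) (fun c hc => ?_) hj
    change star (μ.ι C c) ∈ μ.relKer π
    rw [← μ.ι_involution]
    exact μ.ι_mem_relKer π (by rw [pushforward_involution, hc, involution_zero])

noncomputable instance instCStarRelQuotient (π : GHom C A) :
    NonUnitalCStarAlgebra (μ.obj C ⧸ μ.relKer π) :=
  (μ.isCStarIdeal_relKer π).cstarQuotient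

theorem mk_ι_eq (π : GHom C A) {c c' : C_c(G, C)} (h : pushforward π c = pushforward π c') :
    (Submodule.Quotient.mk (μ.ι C c) : μ.obj C ⧸ μ.relKer π) =
      Submodule.Quotient.mk (μ.ι C c') := by
  rw [Submodule.Quotient.eq, ← map_sub]
  refine μ.ι_mem_relKer π ?_
  exact (map_sub (pushforwardₗ π) c c').trans (sub_eq_zero.2 h)

theorem norm_mk_ι_le (π : GHom C A) (c : C_c(G, C)) :
    ‖(Submodule.Quotient.mk (μ.ι C c) : μ.obj C ⧸ μ.relKer π)‖ ≤ ‖μ.ι C c‖ :=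
  Submodule.Quotient.norm_mk_le _ _

theorem map_mem_relKer {π : GHom C A} {π' : GHom D B} (ψ : GHom C D) (φ : GHom A B)
    (h : ∀ c, π' (ψ c) = φ (π c)) {x : μ.obj C} (hx : x ∈ μ.relKer π) :
    μ.map ψ x ∈ μ.relKer π' := by
  refine μ.relKer_induction π (s := {x | μ.map ψ x ∈ μ.relKer π'})
    ((Submodule.isClosed_topologicalClosure _).preimage (continuous_starHom (μ.map ψ)))
    (fun c hc => ?_) hx
  change μ.map ψ (μ.ι C c) ∈ μ.relKer π'
  rw [μ.map_ι]
  refine μ.ι_mem_relKer π' ?_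
  ext t
  have : π (c t) = 0 := DFunLike.congr_fun hc t
  change π' (ψ (c t)) = 0
  rw [h, this]
  exact map_zero φ.toHom

theorem norm_mk_map_le {π : GHom C A} {π' : GHom D B} (ψ : GHom C D) (φ : GHom A B)
    (h : ∀ c, π' (ψ c) = φ (π c)) (x : μ.obj C) :
    ‖(Submodule.Quotient.mk (μ.map ψ x) : μ.obj D ⧸ μ.relKer π')‖ ≤
      ‖(Submodule.Quotient.mk x : μ.obj C ⧸ μ.relKer π)‖ := by
  refine le_of_forall_pos_le_add fun ε hε => ?_
  obtain ⟨m, hm, hmn⟩ := Submodule.Quotient.norm_mk_lt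
    (Submodule.Quotient.mk x : μ.obj C ⧸ μ.relKer π) hε
  have h1 : (Submodule.Quotient.mk (μ.map ψ x) : μ.obj D ⧸ μ.relKer π') =
      Submodule.Quotient.mk (μ.map ψ m) := by
    rw [Submodule.Quotient.eq, ← map_sub]
    exact μ.map_mem_relKer ψ φ h ((Submodule.Quotient.eq _).1 hm.symm)
  rw [h1]
  exact (Submodule.Quotient.norm_mk_le _ _).trans
    ((NonUnitalStarAlgHom.norm_apply_le (μ.map ψ) m).trans hmn.le)

variable [T2Space G]

/-- Functoriality of the `π`-norms. -/
theorem piNorm_pushforward_le {π : GHom C A} (hπ : Function.Surjective π) {π' : GHom D B}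
    (ψ : GHom C D) (φ : GHom A B) (h : ∀ c, π' (ψ c) = φ (π c)) (f : C_c(G, A)) :
    μ.piNorm π' (pushforward φ f) ≤ μ.piNorm π f := by
  obtain ⟨c, rfl⟩ := pushforward_surjective π hπ f
  have e : pushforward φ (pushforward π c) = pushforward π' (pushforward ψ c) := by
    ext t; exact (h (c t)).symm
  rw [e, μ.piNorm_pushforward, μ.piNorm_pushforward, ← μ.map_ι]
  exact μ.norm_mk_map_le ψ φ h _

/-- The `π`-norms dominate the `μ`-norm. -/
theorem norm_ι_le_piNorm {π : GHom C A} (hπ : Function.Surjective π) (f : C_c(G, A)) :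
    ‖μ.ι A f‖ ≤ μ.piNorm π f := by
  obtain ⟨c, rfl⟩ := pushforward_surjective π hπ f
  rw [μ.piNorm_pushforward]
  refine le_of_forall_pos_le_add fun ε hε => ?_
  obtain ⟨m, hm, hmn⟩ := Submodule.Quotient.norm_mk_lt
    (Submodule.Quotient.mk (μ.ι C c) : μ.obj C ⧸ μ.relKer π) hε
  have h0 : μ.map π (m - μ.ι C c) = 0 := by
    refine μ.relKer_induction π (s := {x | μ.map π x = 0})
      (isClosed_eq (continuous_starHom (μ.map π)) continuous_const) (fun k hk => ?_)
      ((Submodule.Quotient.eq _).1 hm)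
    change μ.map π (μ.ι C k) = 0
    rw [μ.map_ι, hk, map_zero]
  rw [map_sub, sub_eq_zero, μ.map_ι] at h0
  rw [← h0]
  exact (NonUnitalStarAlgHom.norm_apply_le (μ.map π) m).trans hmn.le

/-- The map from `C_c(G, A)` to `(C ⋊_μ G) / (I ⋊_{μ,C} G)` for a surjection `π : C → A`
with kernel `I`. -/
noncomputable def piRep (π : GHom C A) (hπ : Function.Surjective π) :
    C_c(G, A) →ₗ[ℂ] (μ.obj C ⧸ μ.relKer π) where
  toFun f := Submodule.Quotient.mk (μ.ι C (Function.surjInv (pushforward_surjective π hπ) f))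
  map_add' f g := by
    rw [← Submodule.Quotient.mk_add, ← map_add]
    refine μ.mk_ι_eq π ?_
    refine Eq.trans ?_ (map_add (pushforwardₗ π) _ _).symm
    change _ = pushforward π _ + pushforward π _
    simp only [Function.surjInv_eq]
  map_smul' a f := by
    rw [RingHom.id_apply, ← Submodule.Quotient.mk_smul, ← map_smul]
    refine μ.mk_ι_eq π ?_
    refine Eq.trans ?_ (map_smul (pushforwardₗ π) _ _).symm
    change _ = a • pushforward π _
    simp only [Function.surjInv_eq]

theorem piRep_pushforward (π : GHom C A) (hπ : Function.Surjective π) (c : C_c(G, C)) :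
    μ.piRep π hπ (pushforward π c) = Submodule.Quotient.mk (μ.ι C c) :=
  μ.mk_ι_eq π (Function.surjInv_eq _ _)

theorem norm_piRep (π : GHom C A) (hπ : Function.Surjective π) (f : C_c(G, A)) :
    ‖μ.piRep π hπ f‖ = μ.piNorm π f := by
  obtain ⟨c, rfl⟩ := pushforward_surjective π hπ f
  rw [piRep_pushforward, piNorm_pushforward]

/-- The `L¹`-bound holds on `C_c(G, C)` and is transported to `A` by choosing lifts of controlled
norm. The constant `k` comes from the open mapping theorem for `C(K, C) → C(K, A)`. Its dependence
on `π` is harmless, since local boundedness only serves to reach the bound by the maximal norm. -/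
theorem locallyBounded_piRep (π : GHom C A) (hπ : Function.Surjective π) :
    LocallyBounded (μ.piRep π hπ) := by
  intro K _ c
  let Φ := compStarHom K π.toHom
  let L : C(K, C) →L[ℂ] C(K, A) := ⟨(Φ : C(K, C) →ₗ[ℂ] C(K, A)), continuous_starHom Φ⟩
  obtain ⟨k, hk, hL⟩ := L.exists_preimage_norm_le (compStarHom_surjective π.toHom hπ)
  have hI : 0 ≤ ∫ s, c.χ s ∂(Measure.haar : Measure G) := integral_nonneg fun s => (c.mem_Icc s).1
  refine ⟨(∫ s, c.χ s ∂Measure.haar) * k, fun f => ?_⟩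
  obtain ⟨g, rfl, hg⟩ := hL f
  have e : c.extend (L g) = pushforward π (c.extend g) := by
    ext t
    by_cases ht : t ∈ K
    · rw [pushforward_apply, c.extend_apply _ ht, c.extend_apply _ ht]
      exact (map_smul π.toHom _ _).symm
    · rw [pushforward_apply, c.extend_apply_of_notMem _ ht, c.extend_apply_of_notMem _ ht]
      exact (map_zero π.toHom).symm
  rw [e, piRep_pushforward]
  calc _ ≤ ‖μ.ι C (c.extend g)‖ := μ.norm_mk_ι_le π _
    _ ≤ ∫ s, ‖c.extend g s‖ ∂Measure.haar := (μ.le_max _ _).trans (maxNorm_le_integral _)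
    _ ≤ ∫ s, c.χ s * ‖g‖ ∂Measure.haar := by
        refine integral_mono ?_ ?_ (c.norm_extend_le g)
        · exact (c.extend g).continuous.norm.integrable_of_hasCompactSupport
            (c.extend g).hasCompactSupport.norm
        · exact (c.χ.continuous.integrable_of_hasCompactSupport c.χ.hasCompactSupport).mul_const _
    _ = (∫ s, c.χ s ∂Measure.haar) * ‖g‖ := integral_mul_const _ _
    _ ≤ (∫ s, c.χ s ∂Measure.haar) * (k * ‖L g‖) := by gcongr
    _ = _ := by ring

theorem isDenseRep_piRep (π : GHom C A) (hπ : Function.Surjective π) :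
    IsDenseRep (μ.piRep π hπ) where
  map_conv f g := by
    obtain ⟨c, rfl⟩ := pushforward_surjective π hπ f
    obtain ⟨d, rfl⟩ := pushforward_surjective π hπ g
    rw [← pushforward_conv, piRep_pushforward, piRep_pushforward, piRep_pushforward, μ.ι_conv]
    exact map_mul (μ.isCStarIdeal_relKer π).mkHom (μ.ι C c) (μ.ι C d)
  map_involution f := by
    obtain ⟨c, rfl⟩ := pushforward_surjective π hπ f
    rw [← pushforward_involution, piRep_pushforward, piRep_pushforward, μ.ι_involution]
    exact map_star (μ.isCStarIdeal_relKer π).mkHom (μ.ι C c)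
  dense := by
    have h1 : DenseRange fun c => (Submodule.Quotient.mk (μ.ι C c) : μ.obj C ⧸ μ.relKer π) :=
      (Submodule.Quotient.mk_surjective _).denseRange.comp (μ.ι_dense C)
        (continuous_starHom (μ.isCStarIdeal_relKer π).mkHom)
    refine h1.mono ?_
    rintro _ ⟨c, rfl⟩
    exact ⟨pushforward π c, μ.piRep_pushforward π hπ c⟩
  locallyBounded := μ.locallyBounded_piRep π hπ

variable (A) in
/-- The supremum of the `π`-norms is attained, by the same surjection for all functions. -/
theorem exists_universal_surjection : ∃ (C : GAlgebra G) (π : GHom C A),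
    Function.Surjective π ∧ ∀ (D : GAlgebra G) (π' : GHom D A), Function.Surjective π' →
      ∀ f, μ.piNorm π' f ≤ μ.piNorm π f := by
  -- Indexing by the norm functions rather than by the surjections keeps the index type in `Type u`,
  -- as the fibre product requires.
  let ι : Type u := {N : C_c(G, A) → ℝ // ∃ (C : GAlgebra G) (π : GHom C A),
    Function.Surjective π ∧ N = μ.piNorm π}
  choose C π hπ hN using fun i : ι => i.2
  refine ⟨fibreProduct π, fibreProductBase π, fibreProductBase_surjective π hπ,
    fun D π' hπ' f => ?_⟩
  let i : ι := ⟨μ.piNorm π', D, π', hπ', rfl⟩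
  have h1 : μ.piNorm π' f = μ.piNorm (π i) f := congrFun (hN i) f
  rw [h1]
  exact μ.piNorm_pushforward_le (fibreProductBase_surjective π hπ) (fibreProductProj π i)
    (GHom.id A) (fibreProduct_condition π i) f

end CrossedProductFunctor

end ExoticCrossedProduct

namespace ExoticCrossedProduct

universe u

/-! ### The half-exactification -/

variable {G : Type u} [Group G] [TopologicalSpace G] [IsTopologicalGroup G]
  [LocallyCompactSpace G] [MeasurableSpace G] [BorelSpace G]

section Extension

variable {A B : GAlgebra G} {X Y : Type u} [NonUnitalCStarAlgebra X] [NonUnitalCStarAlgebra Y]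
  {κ : C_c(G, A) →ₗ[ℂ] X} {l : C_c(G, B) →ₗ[ℂ] Y} (hκ : IsDenseRep κ) (hl : IsDenseRep l)
  (φ : GHom A B) (h : ∀ f, ‖l (pushforward φ f)‖ ≤ ‖κ f‖)

/-- The continuous linear extension of `f ↦ φ ∘ f`. -/
noncomputable def extendPushforwardCLM (κ : C_c(G, A) →ₗ[ℂ] X) (l : C_c(G, B) →ₗ[ℂ] Y)
    (φ : GHom A B) : X →L[ℂ] Y := (l.comp (pushforwardₗ φ)).extendOfNorm κ

theorem extendPushforwardCLM_apply (hκ : IsDenseRep κ) (φ : GHom A B)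
    (h : ∀ f, ‖l (pushforward φ f)‖ ≤ ‖κ f‖) (f : C_c(G, A)) :
    extendPushforwardCLM κ l φ (κ f) = l (pushforward φ f) :=
  LinearMap.extendOfNorm_eq hκ.dense ⟨1, fun f => (h f).trans_eq (one_mul _).symm⟩ f

/-- The extension of `f ↦ φ ∘ f` to a `*`-homomorphism. -/
noncomputable def extendPushforward : X →⋆ₙₐ[ℂ] Y where
  toFun := extendPushforwardCLM κ l φ
  map_smul' := map_smul _
  map_zero' := map_zero _
  map_add' := map_add _
  map_mul' x y := by
    induction x, y using hκ.dense.induction_on₂ with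
    | hp => exact isClosed_eq (by fun_prop) (by fun_prop)
    | h f g =>
      simp only [← hκ.map_conv, extendPushforwardCLM_apply hκ φ h, pushforward_conv, hl.map_conv]
  map_star' x := by
    induction x using hκ.dense.induction_on with
    | hp => exact isClosed_eq (by fun_prop) (by fun_prop)
    | ih f =>
      simp only [← hκ.map_involution, extendPushforwardCLM_apply hκ φ h, pushforward_involution,
        hl.map_involution]

theorem extendPushforward_apply (f : C_c(G, A)) :
    extendPushforward hκ hl φ h (κ f) = l (pushforward φ f) :=
  extendPushforwardCLM_apply hκ φ h f

end Extension

namespace CrossedProductFunctor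

theorem IsHalfExactification.piNorm_le {μ E : CrossedProductFunctor G}
    (hE : μ.IsHalfExactification E) {A D : GAlgebra G} {π : GHom D A}
    (hπ : Function.Surjective π) (f : C_c(G, A)) : μ.piNorm π f ≤ ‖E.ι A f‖ :=
  (hE A f).1 ⟨D, π, hπ, rfl⟩

variable [T2Space G] (μ : CrossedProductFunctor G)

/-- A surjection onto `A` for which all `π`-norms are maximal. -/
noncomputable def universalCover (A : GAlgebra G) : GAlgebra G :=
  (μ.exists_universal_surjection A).choose

/-- The covering map of `universalCover`. -/
noncomputable def universalMap (A : GAlgebra G) : GHom (μ.universalCover A) A :=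
  (μ.exists_universal_surjection A).choose_spec.choose

theorem universalMap_surjective (A : GAlgebra G) : Function.Surjective (μ.universalMap A) :=
  (μ.exists_universal_surjection A).choose_spec.choose_spec.1

theorem piNorm_le_universal {A D : GAlgebra G} {π : GHom D A} (hπ : Function.Surjective π)
    (f : C_c(G, A)) : μ.piNorm π f ≤ μ.piNorm (μ.universalMap A) f :=
  (μ.exists_universal_surjection A).choose_spec.choose_spec.2 D π hπ f

/-- The `E(μ)`-norm is functorial. -/
theorem piNorm_universal_pushforward_le {A B : GAlgebra G} (φ : GHom A B) (f : C_c(G, A)) :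
    μ.piNorm (μ.universalMap B) (pushforward φ f) ≤ μ.piNorm (μ.universalMap A) f := by
  -- The pullback of the cover of `B` along `φ` is a surjection onto `A` that maps to the cover of
  -- `B` over `φ`.
  have hs := pullbackFst_surjective φ _ (μ.universalMap_surjective B)
  exact (μ.piNorm_pushforward_le hs (pullbackSnd φ (μ.universalMap B)) φ
    (fun c => (pullback_condition φ _ c).symm) f).trans (μ.piNorm_le_universal hs f)

/-- The map `C_c(G, A) → A ⋊_{E(μ)} G`. -/
noncomputable def universalRep (A : GAlgebra G) :
    C_c(G, A) →ₗ[ℂ] (μ.obj (μ.universalCover A) ⧸ μ.relKer (μ.universalMap A)) :=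
  μ.piRep (μ.universalMap A) (μ.universalMap_surjective A)

theorem isDenseRep_universalRep (A : GAlgebra G) : IsDenseRep (μ.universalRep A) :=
  μ.isDenseRep_piRep _ _

theorem norm_universalRep {A : GAlgebra G} (f : C_c(G, A)) :
    ‖μ.universalRep A f‖ = μ.piNorm (μ.universalMap A) f :=
  μ.norm_piRep _ _ f

theorem norm_universalRep_pushforward_le {A B : GAlgebra G} (φ : GHom A B) (f : C_c(G, A)) :
    ‖μ.universalRep B (pushforward φ f)‖ ≤ ‖μ.universalRep A f‖ := by
  rw [norm_universalRep, norm_universalRep]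
  exact μ.piNorm_universal_pushforward_le φ f

theorem norm_ι_le_norm_universalRep {A : GAlgebra G} (f : C_c(G, A)) :
    ‖μ.ι A f‖ ≤ ‖μ.universalRep A f‖ := by
  rw [norm_universalRep]
  exact μ.norm_ι_le_piNorm (μ.universalMap_surjective A) f

/-- The functor `⋊_{E(μ)}`. -/
noncomputable def halfExactification : CrossedProductFunctor G where
  obj A := μ.obj (μ.universalCover A) ⧸ μ.relKer (μ.universalMap A)
  ι A := μ.universalRep A
  ι_conv A := (μ.isDenseRep_universalRep A).map_conv
  ι_involution A := (μ.isDenseRep_universalRep A).map_involution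
  ι_injective A := by
    rw [injective_iff_map_eq_zero]
    intro f hf
    have h := μ.norm_ι_le_norm_universalRep f
    rw [hf, norm_zero] at h
    exact (map_eq_zero_iff _ (μ.ι_injective A)).1 (norm_le_zero_iff.1 h)
  ι_dense A := (μ.isDenseRep_universalRep A).dense
  regular_le A f ξ := (μ.regular_le A f ξ).trans
    (mul_le_mul_of_nonneg_right (μ.norm_ι_le_norm_universalRep f) (Real.sqrt_nonneg _))
  le_max A f := (μ.isDenseRep_universalRep A).norm_le_maxNorm f
  map {A B} φ := extendPushforward (μ.isDenseRep_universalRep A) (μ.isDenseRep_universalRep B) φ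
    (μ.norm_universalRep_pushforward_le φ)
  map_ι {A B} φ f := extendPushforward_apply (μ.isDenseRep_universalRep A)
    (μ.isDenseRep_universalRep B) φ (μ.norm_universalRep_pushforward_le φ) f

theorem isHalfExactification_halfExactification :
    μ.IsHalfExactification μ.halfExactification := by
  intro A f
  have e : ‖μ.halfExactification.ι A f‖ = μ.piNorm (μ.universalMap A) f := μ.norm_universalRep f
  rw [e]
  refine IsGreatest.isLUB ⟨⟨_, _, μ.universalMap_surjective A, rfl⟩, ?_⟩
  rintro r ⟨D, π, hπ, rfl⟩
  exact μ.piNorm_le_universal hπ f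

variable {μ} {E : CrossedProductFunctor G}

/-- Suprema are unique, so any functor realising the `E(μ)`-norm has the norm of the universal
cover. -/
theorem IsHalfExactification.norm_ι (hE : μ.IsHalfExactification E)
    {A : GAlgebra G} (f : C_c(G, A)) :
    ‖E.ι A f‖ = μ.piNorm (μ.universalMap A) f :=
  (hE A f).unique (μ.isHalfExactification_halfExactification A f) |>.trans (μ.norm_universalRep f)

theorem IsHalfExactification.dominates (hE : μ.IsHalfExactification E) : E.Dominates μ := fun A f => by
  rw [hE.norm_ι]
  exact μ.norm_ι_le_piNorm (μ.universalMap_surjective A) f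

/-- Elements of the kernel of `ρ ⋊ G` are limits of functions with values in the kernel of `ρ`. -/
theorem IsHalfExactification.mem_relKer_of_map_eq_zero (hE : μ.IsHalfExactification E)
    {A B : GAlgebra G} {ρ : GHom A B}
    (hρ : Function.Surjective ρ) {x : E.obj A} (hx : E.map ρ x = 0) : x ∈ E.relKer ρ := by
  have hcl : x ∈ closure ((ccIn (LinearMap.ker (ρ.toHom : A →ₗ[ℂ] B))).map (E.ι A) :
      Set (E.obj A)) := by
    refine Metric.mem_closure_iff.2 fun ε hε => ?_
    obtain ⟨f, hf⟩ := (E.ι_dense A).exists_dist_lt x (half_pos hε)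
    let π := μ.universalMap A
    obtain ⟨c, hc⟩ := pushforward_surjective π (μ.universalMap_surjective A) f
    have h1 : ‖E.ι B (pushforward ρ f)‖ < ε / 2 := by
      have e : E.ι B (pushforward ρ f) = E.map ρ (E.ι A f - x) := by
        rw [map_sub, hx, sub_zero, E.map_ι]
      rw [e]
      refine (NonUnitalStarAlgHom.norm_apply_le (E.map ρ) _).trans_lt ?_
      rwa [← dist_eq_norm, dist_comm]
    -- The composite competes in the supremum for `B`. A small `E`-norm of `ρ ∘ f` thus bounds the
    -- class of `c` modulo functions with values in `ker (ρ ∘ π)`.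
    have hs : Function.Surjective (ρ.comp π) := hρ.comp (μ.universalMap_surjective A)
    have h2 := (hE.piNorm_le hs (pushforward ρ f)).trans_lt h1
    rw [← hc, ← pushforward_comp, μ.piNorm_pushforward] at h2
    obtain ⟨m, hm, hmn⟩ := Submodule.Quotient.norm_mk_lt
      (Submodule.Quotient.mk (μ.ι _ c) : _ ⧸ μ.relKer (ρ.comp π)) (sub_pos.2 h2)
    rw [add_sub_cancel] at hmn
    have hm' : m - μ.ι _ c ∈ closure _ := (Submodule.Quotient.eq _).1 hm
    obtain ⟨_, ⟨k, hk, rfl⟩, hkm⟩ := Metric.mem_closure_iff.1 hm' _ (sub_pos.2 hmn)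
    have h3 : ‖μ.ι _ (c + k)‖ < ε / 2 := by
      have e : μ.ι _ (c + k) = m - (m - μ.ι _ c - μ.ι _ k) := by rw [map_add]; abel
      rw [dist_eq_norm] at hkm
      rw [e]
      linarith [norm_sub_le m (m - μ.ι _ c - μ.ι _ k)]
    -- As `k` takes values in `ker (ρ ∘ π)`, `π ∘ k` takes values in `ker ρ`. Its distance from `-f`
    -- is at most the `μ`-norm of `c + k`, as that function lifts the sum.
    refine ⟨E.ι A (-pushforward π k), ⟨_, ?_, rfl⟩, ?_⟩
    · exact Submodule.neg_mem _ fun t => hk t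
    · have h4 : ‖E.ι A f - E.ι A (-pushforward π k)‖ < ε / 2 := by
        have e : E.ι A f - E.ι A (-pushforward π k) = E.ι A (pushforward π (c + k)) := by
          rw [← map_sub, sub_neg_eq_add, ← hc]
          exact congrArg _ (map_add (pushforwardₗ π) c k).symm
        rw [e, hE.norm_ι, μ.piNorm_pushforward]
        exact (μ.norm_mk_ι_le π _).trans_lt h3
      rw [dist_eq_norm] at hf ⊢
      have := norm_add_le (x - E.ι A f) (E.ι A f - E.ι A (-pushforward π k))
      rw [sub_add_sub_cancel] at this
      linarith
  exact hcl

/-- Only exactness in the middle needs the supremum. The remaining claims follow from lifting of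
functions, continuity and closed range. -/
theorem IsHalfExactification.halfExact (hE : μ.IsHalfExactification E) : E.HalfExact := by
  intro I A B j ρ _ hex hρ
  have hker : LinearMap.range (j.toHom : I →ₗ[ℂ] A) = LinearMap.ker (ρ.toHom : A →ₗ[ℂ] B) :=
    Submodule.ext fun a => (hex a).symm
  refine ⟨Subtype.val_injective, fun x => ⟨fun hx => ?_, ?_⟩, ?_⟩
  · refine ⟨⟨x, ?_⟩, rfl⟩
    rw [hker]
    exact hE.mem_relKer_of_map_eq_zero hρ hx
  · rintro ⟨⟨x, hx⟩, rfl⟩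
    rw [hker] at hx
    refine E.relKer_induction ρ (s := {x | E.map ρ x = 0})
      (isClosed_eq (continuous_starHom (E.map ρ)) continuous_const) (fun c hc => ?_) hx
    change E.map ρ (E.ι A c) = 0
    rw [E.map_ι, hc, map_zero]
  · refine surjective_of_denseRange _ ((E.ι_dense B).mono ?_)
    rintro _ ⟨f, rfl⟩
    obtain ⟨c, rfl⟩ := pushforward_surjective ρ hρ f
    exact ⟨E.ι A c, E.map_ι ρ c⟩

/-- The `π`-norms are dominated by the norm of any half-exact functor that dominates `⋊_μ`. -/
theorem piNorm_le_of_halfExact {ν : CrossedProductFunctor G} (hν : ν.HalfExact)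
    (hνμ : ν.Dominates μ) {A C : GAlgebra G} {π : GHom C A} (hπ : Function.Surjective π)
    (f : C_c(G, A)) : μ.piNorm π f ≤ ‖ν.ι A f‖ := by
  obtain ⟨c, rfl⟩ := pushforward_surjective π hπ f
  rw [← ν.map_ι]
  refine le_of_forall_pos_le_add fun ε hε => ?_
  obtain ⟨x, hx, hxn⟩ := exists_preimage_norm_lt (ν.map π) (ν.ι C c) (half_pos hε)
  have h0 : ν.map π (x - ν.ι C c) = 0 := by rw [map_sub, hx, sub_self]
  -- Half-exactness of `ν` puts the difference of `x` and the image of `c` in the closure of `C_c(G,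
  -- ker π)`. Correcting `c` by some `k` there gives another lift, with `ν`-norm within `ε` of that
  -- of `π ∘ c`.
  obtain ⟨⟨y, hy⟩, rfl : y = _⟩ := ((hν (kernel π) C A (kernelInclusion π) π
    (kernelInclusion_injective π) (exact_kernelInclusion π) hπ).2.1 _).1 h0
  rw [range_kernelInclusion] at hy
  have hy' : x - ν.ι C c ∈ closure _ := hy
  obtain ⟨_, ⟨k, hk, rfl⟩, hkx⟩ := Metric.mem_closure_iff.1 hy' _ (half_pos hε)
  have e1 : ‖ν.ι C (c + k)‖ ≤ ‖ν.map π (ν.ι C c)‖ + ε := by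
    have e : ν.ι C (c + k) = x - (x - ν.ι C c - ν.ι C k) := by rw [map_add]; abel
    rw [dist_eq_norm] at hkx
    rw [e]
    linarith [norm_sub_le x (x - ν.ι C c - ν.ι C k)]
  have e2 : pushforward π c = pushforward π (c + k) := by
    ext t
    have : π.toHom (k t) = 0 := hk t
    change π.toHom (c t) = π.toHom (c t + k t)
    rw [map_add, this, add_zero]
  rw [e2, μ.piNorm_pushforward]
  exact (μ.norm_mk_ι_le π _).trans ((hνμ C _).trans e1)

end CrossedProductFunctor

end ExoticCrossedProduct

theorem proposition2p6 {G : Type*} [Group G] [TopologicalSpace G] [IsTopologicalGroup G]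
    [LocallyCompactSpace G] [T2Space G] [MeasurableSpace G] [BorelSpace G]
    (μ : ExoticCrossedProduct.CrossedProductFunctor G) :
    (∃ E : ExoticCrossedProduct.CrossedProductFunctor G, μ.IsHalfExactification E) ∧
    ∀ E : ExoticCrossedProduct.CrossedProductFunctor G, μ.IsHalfExactification E →
      E.HalfExact ∧
      E.Dominates μ ∧
      ∀ ν : ExoticCrossedProduct.CrossedProductFunctor G,
        ν.HalfExact → ν.Dominates μ → ν.Dominates E := by
  refine ⟨⟨μ.halfExactification, μ.isHalfExactification_halfExactification⟩, fun E hE =>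
    ⟨hE.halfExact, hE.dominates, fun ν hν hνμ A f => (hE A f).2 ?_⟩⟩
  rintro r ⟨C, π, hπ, rfl⟩
  exact ExoticCrossedProduct.CrossedProductFunctor.piNorm_le_of_halfExact hν hνμ hπ f
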